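/- Let $n\ge 2$ and $0<a<b$. For a convex domain (open convex set) $D\subset\mathbb R^n$ with $B^n(0,a)\subset D\subset B^n(0,b)$, let $\varphi:S^{n-1}\to\partial D$ be the inverse of the radial projection $x\mapsto x/|x|$ of $\partial D$ onto the unit sphere $S^{n-1}$. For distinct $x,z\in\partial D$ let $\alpha(z,x)\in[0,\pi/2]$ be the acute angle between the segment $[z,x]$ and the ray from $0$ through $x$, and put $$\alpha(x)=\liminf_{z\to x,\;z\in\partial D\setminus\{x\}}\alpha(z,x),\qquad \alpha_D=\inf_{x\in\partial D}\alpha(x).$$ Define $\varphi^\circ(x)=|x|^{1/\sin\alpha_D}\,\varphi(x/|x|)$ for $x\ne0$, and $\varphi^\circ(0)=0$. A homeomorphism $f:U\to V$ between domains of $\mathbb R^n$ is called quasiconformal if it is ACL, differentiable a.e., and there is a constant $C\ge1$ with $\Lambda_f(x)^n/C\le |J(x,f)|\le C\lambda_f(x)^n$ for a.e. $x\in U$, where $\Lambda_f(x)=\max_{|h|=1}|f'(x)h|$ and $\lambda_f(x)=\min_{|h|=1}|f'(x)h|$. Its linear dilatation is $H(f)=\operatorname{ess\,sup}_{x\in U}\Lambda_f(x)/\lambda_f(x)$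 (with the value $\infty$ where $J(x,f)=0$). Then every such $D$ is strictly starlike with respect to $0$ (each ray from $0$ meets $\partial D$ in exactly one point); $\alpha_D\in(0,\pi/2]$, so that $\alpha_D$ is the largest $\alpha\in(0,\pi/2]$ with $\alpha(x)\ge\alpha$ for all $x\in\partial D$; $\varphi^\circ$ is a quasiconformal mapping of the unit ball $\mathbb B^n$ onto $D$; and $$\inf_f H(f)\;\le\; H(\varphi^\circ)=\cot\frac{\alpha_D}{2}\;\le\;\frac{b+\sqrt{b^2-a^2}}{a}\;<\;2\cdot\frac ba ,$$ where $H(\varphi^\circ)$ is taken over $\mathbb B^n$ and the infimum is over all quasiconformal mappings $f$ of $\mathbb B^n$ onto $D$. Equality $H(\varphi^\circ)=(b+\sqrt{b^2-a^2})/a$ holds if and only if $\alpha_D=\arcsin(a/b)$, and for all $n\ge2$ and $0<a<b$ there is a convex domain $D$ with $B^n(0,a)\subset D\subset B^n(0,b)$ for which it holds. -/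

import Mathlib

open Set Filter Topology MeasureTheory

noncomputable section

/-! ### Linear dilatation and quasiconformal mappings -/

/-- `Λ(A) = max {|A h| : |h| = 1}`. -/
def maxStretch {n : ℕ} (A : EuclideanSpace ℝ (Fin n) →L[ℝ] EuclideanSpace ℝ (Fin n)) : ℝ :=
  sSup ((fun h => ‖A h‖) '' Metric.sphere 0 1)

/-- `λ(A) = min {|A h| : |h| = 1}`. -/
def minStretch {n : ℕ} (A : EuclideanSpace ℝ (Fin n) →L[ℝ] EuclideanSpace ℝ (Fin n)) : ℝ :=
  sInf ((fun h => ‖A h‖) '' Metric.sphere 0 1)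

open Classical in
/-- `H(A) = Λ(A) / λ(A)` for a bijective linear map `A`, and `∞` for a degenerate one. -/
def linearDilatation {n : ℕ} (A : EuclideanSpace ℝ (Fin n) →L[ℝ] EuclideanSpace ℝ (Fin n)) :
    ENNReal :=
  if A.det = 0 then ⊤ else ENNReal.ofReal (maxStretch A / minStretch A)

/-- `H(f) = ess sup_{x ∈ U} H(f'(x))`. -/
def essLinearDilatation {n : ℕ} (f : EuclideanSpace ℝ (Fin n) → EuclideanSpace ℝ (Fin n))
    (U : Set (EuclideanSpace ℝ (Fin n))) : ENNReal :=
  essSup (fun x => linearDilatation (fderiv ℝ f x)) (volume.restrict U)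

/-- `f` maps `U` homeomorphically onto `V`. -/
def IsHomeoOnto {n : ℕ} (f : EuclideanSpace ℝ (Fin n) → EuclideanSpace ℝ (Fin n))
    (U V : Set (EuclideanSpace ℝ (Fin n))) : Prop :=
  BijOn f U V ∧ ContinuousOn f U ∧
    ∃ g : EuclideanSpace ℝ (Fin n) → EuclideanSpace ℝ (Fin n),
      ContinuousOn g V ∧ LeftInvOn g f U

/-- The point whose `k`-th coordinate is `t` and whose other coordinates are given by `y`. -/
def insertCoord {n : ℕ} (k : Fin n) (t : ℝ) (y : {i : Fin n // i ≠ k} → ℝ) :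
    EuclideanSpace ℝ (Fin n) :=
  WithLp.toLp 2 (fun i => if h : i = k then t else y ⟨i, h⟩)

/-- `f` is ACL (absolutely continuous on lines) in `U`: it is continuous in `U` and, for every
closed box `{x : p i ≤ x i ≤ q i}` contained in `U` and every coordinate direction `k`, it is
absolutely continuous on almost every segment of the box parallel to the `k`-th axis. -/
def IsACL {n : ℕ} (f : EuclideanSpace ℝ (Fin n) → EuclideanSpace ℝ (Fin n))
    (U : Set (EuclideanSpace ℝ (Fin n))) : Prop :=
  ContinuousOn f U ∧
    ∀ p q : Fin n → ℝ, (∀ i, p i < q i) →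
      {x : EuclideanSpace ℝ (Fin n) | ∀ i, x i ∈ Icc (p i) (q i)} ⊆ U →
      ∀ k : Fin n, ∀ᵐ y : {i : Fin n // i ≠ k} → ℝ,
        (∀ i : {i : Fin n // i ≠ k}, y i ∈ Icc (p i) (q i)) →
          AbsolutelyContinuousOnInterval (fun t => f (insertCoord k t y)) (p k) (q k)

/-- Quasiconformal mappings of `U` onto `V` (analytic definition): a homeomorphism which is ACL,
differentiable a.e., and satisfies `Λ^n / C ≤ |J| ≤ C λ^n` a.e. for some constant `C`. -/
def IsQuasiconformal {n : ℕ} (f : EuclideanSpace ℝ (Fin n) → EuclideanSpace ℝ (Fin n))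
    (U V : Set (EuclideanSpace ℝ (Fin n))) : Prop :=
  IsHomeoOnto f U V ∧ IsACL f U ∧
    (∀ᵐ x ∂(volume.restrict U), DifferentiableAt ℝ f x) ∧
    ∃ C : ℝ, 1 ≤ C ∧ ∀ᵐ x ∂(volume.restrict U),
      maxStretch (fderiv ℝ f x) ^ n / C ≤ |(fderiv ℝ f x).det| ∧
        |(fderiv ℝ f x).det| ≤ C * minStretch (fderiv ℝ f x) ^ n

/-- `inf H(f)` over all quasiconformal mappings `f` of the unit ball onto `D`. -/
def infLinearDilatation {n : ℕ} (D : Set (EuclideanSpace ℝ (Fin n))) : ENNReal :=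
  ⨅ (f : EuclideanSpace ℝ (Fin n) → EuclideanSpace ℝ (Fin n))
    (_ : IsQuasiconformal f (Metric.ball 0 1) D), essLinearDilatation f (Metric.ball 0 1)

/-! ### Starlike domains and radial extensions -/

/-- `D` is a bounded domain containing `0`, each ray from `0` meets `∂D` at exactly one point. -/
def IsStrictlyStarlike {n : ℕ} (D : Set (EuclideanSpace ℝ (Fin n))) : Prop :=
  IsOpen D ∧ IsConnected D ∧ Bornology.IsBounded D ∧ 0 ∈ D ∧
    ∀ u : EuclideanSpace ℝ (Fin n), u ≠ 0 → ∃! w, w ∈ frontier D ∧ ∃ t : ℝ, 0 < t ∧ w = t • u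

/-- The radial projection `x ↦ x / |x|` to the unit sphere. -/
def radialProjection {n : ℕ} (x : EuclideanSpace ℝ (Fin n)) : EuclideanSpace ℝ (Fin n) :=
  ‖x‖⁻¹ • x

/-- The polar parametrization `φ : S^{n-1} → ∂D`, the inverse of the radial projection on `∂D`. -/
def polarParam {n : ℕ} (D : Set (EuclideanSpace ℝ (Fin n))) :
    EuclideanSpace ℝ (Fin n) → EuclideanSpace ℝ (Fin n) :=
  Function.invFunOn radialProjection (frontier D)

open Classical in
/-- The radial extension `x ↦ |x|^s φ(x / |x|)`, `0 ↦ 0`. -/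
def radialExtension {n : ℕ} (D : Set (EuclideanSpace ℝ (Fin n))) (s : ℝ)
    (x : EuclideanSpace ℝ (Fin n)) : EuclideanSpace ℝ (Fin n) :=
  if x = 0 then 0 else (‖x‖ ^ s) • polarParam D (radialProjection x)

/-- The acute angle (in `[0, π/2]`) between the segment `[z, x]` and the ray from `0` through `x`. -/
def segmentAngle {n : ℕ} (z x : EuclideanSpace ℝ (Fin n)) : ℝ :=
  min (InnerProductGeometry.angle (z - x) x) (Real.pi - InnerProductGeometry.angle (z - x) x)

/-- `α(x) = liminf α(z, x)` as `z → x`, `z ∈ ∂D`, `z ≠ x`. -/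
def tangentAngle {n : ℕ} (D : Set (EuclideanSpace ℝ (Fin n))) (x : EuclideanSpace ℝ (Fin n)) : ℝ :=
  liminf (fun z => segmentAngle z x) (𝓝[frontier D \ {x}] x)

/-- The `α`-tangent condition. -/
def TangentCondition {n : ℕ} (D : Set (EuclideanSpace ℝ (Fin n))) (α : ℝ) : Prop :=
  0 < α ∧ α ≤ Real.pi / 2 ∧ ∀ x ∈ frontier D, α ≤ tangentAngle D x

/-- `inf α(x)` over `x ∈ ∂D`. -/
def minTangentAngle {n : ℕ} (D : Set (EuclideanSpace ℝ (Fin n))) : ℝ :=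
  ⨅ x : frontier D, tangentAngle D x

/-- `φ°(x) = |x|^{csc α} φ(x / |x|)`, `φ°(0) = 0`, where `α = inf α(x)` over `x ∈ ∂D`. -/
def phiCirc {n : ℕ} (D : Set (EuclideanSpace ℝ (Fin n))) :
    EuclideanSpace ℝ (Fin n) → EuclideanSpace ℝ (Fin n) :=
  radialExtension D (1 / Real.sin (minTangentAngle D))

end

/-! Everything is expressed through the gauge `p` of `D`, which is sublinear and `1/a`-Lipschitz and
satisfies `|x| ≤ b p(x)`. Since `φ(x/|x|) = x/p(x)`, the radial extension with exponent `s` is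
`|x|^s p(x)⁻¹ x`. By Rademacher's theorem it has almost everywhere a derivative `h ↦ ρ (h + ⟨s e -
N, h⟩ e)`, where `e = x/|x|` and `N = (|x|/p(x)) ∇p(x)`. Euler's identity gives `⟨N, e⟩ = 1`, and
`1/|N|` is the sine of the angle between the ray and the tangent hyperplane.

Up to the factor `ρ` this map is the identity orthogonally to a plane containing `e` and `N - e`. On
the plane it is a triangular matrix whose squared singular values have sum `s² + |N|²` and product
`s²`. Its dilatation `H` satisfies `H + 1/H = (s² + |N|²)/s`, hence increases with `|N|` and equals
`s + √(s² - 1)` when `|N| = s`.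

It remains to see that the essential supremum of `|N|` is `1/sin α_D`. Moving along the boundary in
a tangent direction gives `|N| ≤ 1/sin α_D` almost everywhere (`tangentAngle_le_arcsin`).
Conversely, a bound `|N| ≤ 1/q` almost everywhere makes the supporting hyperplanes steep; convexity
turns this into an inequality between pairs of boundary points, which extends to all pairs by
continuity and yields `α_D ≥ arcsin q` (`inner_sub_le_of_ae`, `arcsin_le_tangentAngle`). With `s =
1/sin α_D` the dilatation is therefore `cot (α_D/2)`. The bound `|N| ≤ b/a` gives `sin α_D ≥ a/b`,
and a ball cut by a half-space shows that this is sharp. -/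

/-- An open convex set lying between two balls centred at the origin. -/
structure IsPinchedConvex {n : ℕ} (D : Set (EuclideanSpace ℝ (Fin n))) (a b : ℝ) : Prop where
  isOpen : IsOpen D
  convex : Convex ℝ D
  pos : 0 < a
  ball_subset : Metric.ball 0 a ⊆ D
  subset_ball : D ⊆ Metric.ball 0 b

/-! ### The gauge of `D` and strict starlikeness -/

namespace IsPinchedConvex

variable {n : ℕ} {D : Set (EuclideanSpace ℝ (Fin n))} {a b : ℝ}

theorem zero_mem (h : IsPinchedConvex D a b) : (0 : EuclideanSpace ℝ (Fin n)) ∈ D :=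
  h.ball_subset (Metric.mem_ball_self h.pos)

theorem mem_nhds (h : IsPinchedConvex D a b) : D ∈ 𝓝 (0 : EuclideanSpace ℝ (Fin n)) :=
  h.isOpen.mem_nhds h.zero_mem

theorem pos_right (h : IsPinchedConvex D a b) : 0 < b := by
  simpa using h.subset_ball h.zero_mem

theorem mul_gauge_le (h : IsPinchedConvex D a b) (x : EuclideanSpace ℝ (Fin n)) :
    a * gauge D x ≤ ‖x‖ :=
  mul_gauge_le_norm h.ball_subset

theorem norm_le_mul_gauge (h : IsPinchedConvex D a b) (x : EuclideanSpace ℝ (Fin n)) :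
    ‖x‖ ≤ b * gauge D x := by
  have := le_gauge_of_subset_closedBall (absorbent_nhds_zero h.mem_nhds) h.pos_right.le
    (h.subset_ball.trans Metric.ball_subset_closedBall) (x := x)
  rw [div_le_iff₀ h.pos_right] at this
  linarith

theorem gauge_pos (h : IsPinchedConvex D a b) {x : EuclideanSpace ℝ (Fin n)} (hx : x ≠ 0) :
    0 < gauge D x := by
  have h1 := h.norm_le_mul_gauge x
  have h2 := norm_pos_iff.2 hx
  exact pos_of_mul_pos_right (h2.trans_le h1) h.pos_right.le

theorem lipschitzWith_gauge (h : IsPinchedConvex D a b) :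
    LipschitzWith ⟨a⁻¹, (inv_pos.2 h.pos).le⟩ (gauge D) :=
  h.convex.lipschitzWith_gauge (r := ⟨a, h.pos.le⟩) h.pos h.ball_subset

theorem continuous_gauge (h : IsPinchedConvex D a b) : Continuous (gauge D) :=
  h.lipschitzWith_gauge.continuous

theorem gauge_sub_le (h : IsPinchedConvex D a b) (x y : EuclideanSpace ℝ (Fin n)) :
    a * |gauge D x - gauge D y| ≤ ‖x - y‖ := by
  have := h.lipschitzWith_gauge.dist_le_mul x y
  rw [Real.dist_eq, dist_eq_norm] at this
  calc _ ≤ a * (a⁻¹ * ‖x - y‖) := mul_le_mul_of_nonneg_left this h.pos.le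
    _ = _ := by rw [mul_inv_cancel_left₀ h.pos.ne']

theorem gauge_smul (c : ℝ) (hc : 0 ≤ c) (x : EuclideanSpace ℝ (Fin n)) :
    gauge D (c • x) = c * gauge D x := by
  rw [gauge_smul_of_nonneg hc, smul_eq_mul]

theorem mem_iff (h : IsPinchedConvex D a b) {x : EuclideanSpace ℝ (Fin n)} :
    x ∈ D ↔ gauge D x < 1 := by
  rw [gauge_lt_one_iff_mem_interior h.convex h.mem_nhds, h.isOpen.interior_eq]

theorem mem_frontier_iff (h : IsPinchedConvex D a b) {x : EuclideanSpace ℝ (Fin n)} :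
    x ∈ frontier D ↔ gauge D x = 1 :=
  (gauge_eq_one_iff_mem_frontier h.convex h.mem_nhds).symm

theorem ne_zero_of_mem_frontier (h : IsPinchedConvex D a b) {x : EuclideanSpace ℝ (Fin n)}
    (hx : x ∈ frontier D) : x ≠ 0 := by
  rintro rfl
  simp [h.mem_frontier_iff] at hx

theorem inv_gauge_smul_mem_frontier (h : IsPinchedConvex D a b) {x : EuclideanSpace ℝ (Fin n)}
    (hx : x ≠ 0) : (gauge D x)⁻¹ • x ∈ frontier D := by
  have := h.gauge_pos hx
  rw [h.mem_frontier_iff, gauge_smul _ (by positivity), inv_mul_cancel₀ this.ne']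

theorem eq_inv_gauge_smul (h : IsPinchedConvex D a b) {u : EuclideanSpace ℝ (Fin n)} {t : ℝ}
    (ht : 0 < t) (hw : t • u ∈ frontier D) : t • u = (gauge D u)⁻¹ • u := by
  rw [h.mem_frontier_iff, gauge_smul _ ht.le] at hw
  rw [eq_inv_of_mul_eq_one_left hw]

theorem isStrictlyStarlike (h : IsPinchedConvex D a b) : IsStrictlyStarlike D := by
  refine ⟨h.isOpen, ⟨⟨0, h.zero_mem⟩, h.convex.isPreconnected⟩,
    Metric.isBounded_ball.subset h.subset_ball, h.zero_mem, fun u hu => ?_⟩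
  refine ⟨(gauge D u)⁻¹ • u, ⟨h.inv_gauge_smul_mem_frontier hu, _,
    inv_pos.2 (h.gauge_pos hu), rfl⟩, ?_⟩
  rintro w ⟨hw, t, ht, rfl⟩
  exact h.eq_inv_gauge_smul ht hw

/-- The ray through `x` meets the boundary only once, so the choice hidden in `Function.invFunOn` is
forced. -/
theorem polarParam_radialProjection (h : IsPinchedConvex D a b) {x : EuclideanSpace ℝ (Fin n)}
    (hx : x ≠ 0) : polarParam D (radialProjection x) = (gauge D x)⁻¹ • x := by
  have hxn := norm_pos_iff.2 hx
  have hg := h.gauge_pos hx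
  have hex : ∃ w ∈ frontier D, radialProjection w = radialProjection x := by
    refine ⟨_, h.inv_gauge_smul_mem_frontier hx, ?_⟩
    unfold radialProjection
    rw [norm_smul, smul_smul, Real.norm_of_nonneg (inv_pos.2 hg).le]
    congr 1
    field_simp
  have h1 := Function.invFunOn_mem hex
  have h2 := Function.invFunOn_eq hex
  change polarParam D (radialProjection x) ∈ frontier D at h1
  change radialProjection (polarParam D (radialProjection x)) = radialProjection x at h2
  generalize polarParam D (radialProjection x) = w at h1 h2
  have hw := norm_pos_iff.2 (h.ne_zero_of_mem_frontier h1)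
  have h3 : w = (‖w‖ * ‖x‖⁻¹) • x := by
    rw [mul_smul, ← radialProjection, ← h2, radialProjection, smul_smul,
      mul_inv_cancel₀ hw.ne', one_smul]
  rw [h3] at h1 ⊢
  exact h.eq_inv_gauge_smul (by positivity) h1

theorem radialExtension_eq (h : IsPinchedConvex D a b) (s : ℝ)
    (x : EuclideanSpace ℝ (Fin n)) :
    radialExtension D s x = (‖x‖ ^ s * (gauge D x)⁻¹) • x := by
  unfold radialExtension
  split_ifs with hx
  · simp [hx]
  · rw [h.polarParam_radialProjection hx, smul_smul]

theorem gauge_radialExtension (h : IsPinchedConvex D a b) {s : ℝ} (hs : 0 < s)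
    (x : EuclideanSpace ℝ (Fin n)) : gauge D (radialExtension D s x) = ‖x‖ ^ s := by
  rw [h.radialExtension_eq]
  by_cases hx : x = 0
  · simp [hx, Real.zero_rpow hs.ne']
  have := h.gauge_pos hx
  rw [gauge_smul _ (by positivity)]
  field_simp

/-! ### The derivative of the gauge -/

/-- Subadditivity bounds the right difference quotients. Together with Euler's identity below, this
is the supporting hyperplane inequality. -/
theorem fderiv_gauge_apply_le (h : IsPinchedConvex D a b) {x : EuclideanSpace ℝ (Fin n)}
    (hx : DifferentiableAt ℝ (gauge D) x) (y : EuclideanSpace ℝ (Fin n)) :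
    fderiv ℝ (gauge D) x y ≤ gauge D y := by
  have h1 := (hx.hasFDerivAt.hasLineDerivAt y)
  rw [HasLineDerivAt, hasDerivAt_iff_tendsto_slope_zero] at h1
  refine le_of_tendsto (h1.mono_left (nhdsWithin_mono 0 (s := Ioi (0 : ℝ)) fun t ht => ne_of_gt ht))
    (eventually_nhdsWithin_of_forall fun t ht => ?_)
  have ht : 0 < t := ht
  have := gauge_add_le h.convex (absorbent_nhds_zero h.mem_nhds) x (t • y)
  rw [gauge_smul _ ht.le] at this
  rw [smul_eq_mul, inv_mul_le_iff₀ ht]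
  simpa [add_comm] using this

theorem fderiv_gauge_apply_self {x : EuclideanSpace ℝ (Fin n)}
    (hx : DifferentiableAt ℝ (gauge D) x) : fderiv ℝ (gauge D) x x = gauge D x := by
  have h1 := (hx.hasFDerivAt.hasLineDerivAt x)
  rw [HasLineDerivAt] at h1
  have h2 : HasDerivAt (fun t : ℝ => (1 + t) * gauge D x) (1 * gauge D x) 0 :=
    ((hasDerivAt_id (0 : ℝ)).const_add 1).mul_const _
  rw [one_mul] at h2
  refine h1.unique (h2.congr_of_eventuallyEq ?_)
  filter_upwards [lt_mem_nhds (show (-1 : ℝ) < 0 by norm_num)] with t ht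
  rw [← gauge_smul _ (by linarith), add_smul, one_smul]

theorem mul_norm_fderiv_gauge_le (h : IsPinchedConvex D a b) {x : EuclideanSpace ℝ (Fin n)} :
    a * ‖fderiv ℝ (gauge D) x‖ ≤ 1 := by
  have := norm_fderiv_le_of_lipschitz ℝ h.lipschitzWith_gauge (x₀ := x)
  calc _ ≤ a * a⁻¹ := mul_le_mul_of_nonneg_left this h.pos.le
    _ = 1 := mul_inv_cancel₀ h.pos.ne'

theorem gauge_le_norm_gradient_mul {x : EuclideanSpace ℝ (Fin n)}
    (hx : DifferentiableAt ℝ (gauge D) x) :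
    gauge D x ≤ ‖gradient (gauge D) x‖ * ‖x‖ := by
  rw [← fderiv_gauge_apply_self hx, gradient, LinearIsometryEquiv.norm_map]
  exact (le_abs_self _).trans ((fderiv ℝ (gauge D) x).le_opNorm x)

theorem inner_gradient_gauge (x y : EuclideanSpace ℝ (Fin n)) :
    inner ℝ (gradient (gauge D) x) y = fderiv ℝ (gauge D) x y := by
  rw [gradient, InnerProductSpace.toDual_symm_apply]

theorem ae_differentiableAt_gauge (h : IsPinchedConvex D a b) :
    ∀ᵐ x : EuclideanSpace ℝ (Fin n), DifferentiableAt ℝ (gauge D) x :=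
  h.lipschitzWith_gauge.ae_differentiableAt

end IsPinchedConvex

/-! ### Angles -/

section Angles

variable {n : ℕ}

theorem segmentAngle_eq_arccos (z x : EuclideanSpace ℝ (Fin n)) :
    segmentAngle z x = Real.arccos |inner ℝ (z - x) x / (‖z - x‖ * ‖x‖)| := by
  rw [segmentAngle, InnerProductGeometry.angle, ← Real.arccos_neg, abs,
    Real.antitone_arccos.map_sup]

theorem segmentAngle_nonneg (z x : EuclideanSpace ℝ (Fin n)) : 0 ≤ segmentAngle z x := by
  rw [segmentAngle_eq_arccos]
  exact Real.arccos_nonneg _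

theorem segmentAngle_le (z x : EuclideanSpace ℝ (Fin n)) : segmentAngle z x ≤ Real.pi / 2 := by
  rw [segmentAngle_eq_arccos, Real.arccos_le_pi_div_two]
  exact abs_nonneg _

theorem isBoundedUnder_segmentAngle (x : EuclideanSpace ℝ (Fin n))
    (l : Filter (EuclideanSpace ℝ (Fin n))) :
    IsBoundedUnder (· ≥ ·) l (fun z => segmentAngle z x) :=
  isBoundedUnder_of ⟨0, fun z => segmentAngle_nonneg z x⟩

theorem isCoboundedUnder_segmentAngle (x : EuclideanSpace ℝ (Fin n))
    (l : Filter (EuclideanSpace ℝ (Fin n))) [l.NeBot] :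
    IsCoboundedUnder (· ≥ ·) l (fun z => segmentAngle z x) :=
  IsBoundedUnder.isCoboundedUnder_ge (isBoundedUnder_of ⟨Real.pi / 2, fun z => segmentAngle_le z x⟩)

theorem exists_norm_eq_one_inner_eq_zero (hn : 2 ≤ n) (e : EuclideanSpace ℝ (Fin n)) :
    ∃ v : EuclideanSpace ℝ (Fin n), ‖v‖ = 1 ∧ inner ℝ e v = 0 := by
  have hne : (ℝ ∙ e)ᗮ ≠ ⊥ := by
    intro hb
    rw [Submodule.orthogonal_eq_bot_iff] at hb
    have h1 := finrank_span_le_card (R := ℝ) ({e} : Set (EuclideanSpace ℝ (Fin n)))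
    rw [hb, finrank_top, finrank_euclideanSpace, Fintype.card_fin] at h1
    simp only [toFinset_singleton, Finset.card_singleton] at h1
    omega
  obtain ⟨v, hv, hv0⟩ := Submodule.exists_mem_ne_zero_of_ne_bot hne
  refine ⟨‖v‖⁻¹ • v, norm_smul_inv_norm hv0, ?_⟩
  rw [inner_smul_right, Submodule.mem_orthogonal_singleton_iff_inner_right.1 hv, mul_zero]

/-- Removing from `z` its component along `ν` can only increase the product with `w`, and what is
left has length at most `√(1 - q²) |z|`. -/
theorem inner_le_of_inner_nonpos {E : Type*} [NormedAddCommGroup E] [InnerProductSpace ℝ E]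
    {ν z w : E} {q : ℝ} (hq : 0 ≤ q) (hν : ν ≠ 0) (hz : q * (‖ν‖ * ‖z‖) ≤ inner ℝ ν z)
    (hw : inner ℝ ν w ≤ 0) : inner ℝ z w ≤ √(1 - q ^ 2) * (‖z‖ * ‖w‖) := by
  have hN := norm_pos_iff.2 hν
  set r := inner ℝ ν z / ‖ν‖ ^ 2 with hr
  have hr0 : 0 ≤ r := div_nonneg ((by positivity : (0 : ℝ) ≤ q * (‖ν‖ * ‖z‖)).trans hz) (by positivity)
  have h1 : inner ℝ z w ≤ inner ℝ (z - r • ν) w := by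
    rw [inner_sub_left, inner_smul_left]
    have := mul_nonpos_of_nonneg_of_nonpos hr0 hw
    simp only [conj_trivial]
    linarith
  have h2 : ‖z - r • ν‖ ^ 2 = ‖z‖ ^ 2 - (inner ℝ ν z / ‖ν‖) ^ 2 := by
    rw [norm_sub_sq_real, inner_smul_right, norm_smul, mul_pow, Real.norm_eq_abs, sq_abs,
      real_inner_comm, hr]
    field_simp
    ring
  have h3 : q * ‖z‖ ≤ inner ℝ ν z / ‖ν‖ := by
    rw [le_div_iff₀ hN]
    linarith
  have h4 : ‖z - r • ν‖ ≤ √(1 - q ^ 2) * ‖z‖ := by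
    rw [← Real.sqrt_sq (norm_nonneg z), ← Real.sqrt_mul' _ (sq_nonneg _)]
    apply Real.le_sqrt_of_sq_le
    rw [h2]
    have := pow_le_pow_left₀ (by positivity) h3 2
    linarith
  calc _ ≤ _ := h1
    _ ≤ _ := real_inner_le_norm _ _
    _ ≤ √(1 - q ^ 2) * ‖z‖ * ‖w‖ := by gcongr
    _ = _ := by ring

end Angles

/-! ### Tangent angles and the gradient of the gauge -/

namespace IsPinchedConvex

variable {n : ℕ} {D : Set (EuclideanSpace ℝ (Fin n))} {a b : ℝ}

/-- Central projection of a line to the boundary. -/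
theorem tendsto_inv_gauge_smul (h : IsPinchedConvex D a b) {y v : EuclideanSpace ℝ (Fin n)}
    (hy : y ≠ 0) :
    Tendsto (fun t : ℝ => (gauge D (y + t • v))⁻¹ • (y + t • v)) (𝓝 0)
      (𝓝 ((gauge D y)⁻¹ • y)) := by
  have h1 : Tendsto (fun t : ℝ => y + t • v) (𝓝 0) (𝓝 y) := by
    have : Continuous (fun t : ℝ => y + t • v) := by fun_prop
    simpa using this.tendsto 0
  exact (((h.continuous_gauge.tendsto y).comp h1).inv₀ (h.gauge_pos hy).ne').smul h1

theorem tendsto_nhdsWithin_frontier (h : IsPinchedConvex D a b)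
    {y v : EuclideanSpace ℝ (Fin n)} (hy : y ≠ 0)
    (hne : ∀ᶠ t : ℝ in 𝓝[≠] 0, (gauge D (y + t • v))⁻¹ • (y + t • v) ≠ (gauge D y)⁻¹ • y) :
    Tendsto (fun t : ℝ => (gauge D (y + t • v))⁻¹ • (y + t • v)) (𝓝[≠] 0)
      (𝓝[frontier D \ {(gauge D y)⁻¹ • y}] ((gauge D y)⁻¹ • y)) := by
  refine tendsto_nhdsWithin_iff.2 ⟨(h.tendsto_inv_gauge_smul hy).mono_left inf_le_left, ?_⟩
  have h1 : Tendsto (fun t : ℝ => y + t • v) (𝓝 0) (𝓝 y) := by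
    have : Continuous (fun t : ℝ => y + t • v) := by fun_prop
    simpa using this.tendsto 0
  filter_upwards [hne, (h1.eventually_ne hy).filter_mono nhdsWithin_le_nhds] with t ht ht'
  exact ⟨h.inv_gauge_smul_mem_frontier ht', ht⟩

/-- Without this the real `liminf` defining the tangent angle would be a junk value. A line through
`y` orthogonal to the ray, projected centrally to the boundary, gives nearby points different from
`y`. -/
theorem neBot_nhdsWithin_frontier (h : IsPinchedConvex D a b) (hn : 2 ≤ n)
    {y : EuclideanSpace ℝ (Fin n)} (hy : y ∈ frontier D) : (𝓝[frontier D \ {y}] y).NeBot := by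
  have hy0 := h.ne_zero_of_mem_frontier hy
  have hg := h.mem_frontier_iff.1 hy
  obtain ⟨v, hv, hv'⟩ := exists_norm_eq_one_inner_eq_zero hn y
  have := h.tendsto_nhdsWithin_frontier hy0 (v := v) ?_
  · rw [hg, inv_one, one_smul] at this
    exact this.neBot
  refine eventually_nhdsWithin_of_forall fun t ht he => ht ?_
  have h1 := congrArg (fun w => inner ℝ w v) he
  simp only [inner_smul_left, inner_add_left, hv', real_inner_self_eq_norm_sq, hv] at h1
  by_contra ht0
  have h2 : y + t • v ≠ 0 := by
    intro h0
    have := congrArg (fun w => inner ℝ w v) h0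
    simp only [inner_smul_left, inner_add_left, hv', real_inner_self_eq_norm_sq, hv] at this
    apply ht0
    simpa using this
  have := h.gauge_pos h2
  simp [this.ne'] at h1
  exact ht0 h1

theorem tangentAngle_le_pi_div_two (h : IsPinchedConvex D a b) (hn : 2 ≤ n)
    {y : EuclideanSpace ℝ (Fin n)} (hy : y ∈ frontier D) : tangentAngle D y ≤ Real.pi / 2 := by
  have := h.neBot_nhdsWithin_frontier hn hy
  refine liminf_le_of_frequently_le ?_ (isBoundedUnder_segmentAngle _ _)
  exact (Eventually.of_forall fun z => segmentAngle_le z y).frequently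

/-- The liminf is at most the limit along a single boundary curve, here one tangent to the
projection of the ray direction onto the tangent hyperplane. -/
theorem tangentAngle_le_arcsin (h : IsPinchedConvex D a b) (hn : 2 ≤ n)
    {x : EuclideanSpace ℝ (Fin n)} (hx : x ≠ 0) (hd : DifferentiableAt ℝ (gauge D) x) :
    tangentAngle D ((gauge D x)⁻¹ • x) ≤
      Real.arcsin (gauge D x / (‖gradient (gauge D) x‖ * ‖x‖)) := by
  set N := gradient (gauge D) x with hN
  have hg := h.gauge_pos hx
  have hxp := norm_pos_iff.2 hx
  have hNx : inner ℝ N x = gauge D x := by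
    rw [inner_gradient_gauge, fderiv_gauge_apply_self hd]
  have hNp : 0 < ‖N‖ := pos_of_mul_pos_left (hg.trans_le (gauge_le_norm_gradient_mul hd)) hxp.le
  set v := x - (gauge D x / ‖N‖ ^ 2) • N with hv
  have hNv : inner ℝ N v = 0 := by
    rw [hv, inner_sub_right, inner_smul_right, hNx, real_inner_self_eq_norm_sq]
    field_simp
    ring
  have hvx : inner ℝ v x = ‖v‖ ^ 2 := by
    rw [← real_inner_self_eq_norm_sq]
    nth_rw 3 [hv]
    rw [inner_sub_right, inner_smul_right, real_inner_comm N v, hNv]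
    ring
  have hvv : ‖v‖ ^ 2 = ‖x‖ ^ 2 - (gauge D x / ‖N‖) ^ 2 := by
    rw [← hvx, hv, inner_sub_left, inner_smul_left, hNx, real_inner_self_eq_norm_sq]
    simp
    field_simp
  -- If `v = 0` the ray is normal to the tangent hyperplane, and the bound is the trivial `π / 2`.
  by_cases hv0 : v = 0
  · have h1 : gauge D x / (‖N‖ * ‖x‖) = 1 := by
      rw [hv0, norm_zero] at hvv
      have : gauge D x / ‖N‖ = ‖x‖ := by
        refine (pow_left_inj₀ (by positivity) (by positivity) two_ne_zero).1 ?_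
        linarith
      rw [← div_div, this, div_self hxp.ne']
    rw [h1, Real.arcsin_one]
    exact h.tangentAngle_le_pi_div_two hn (h.inv_gauge_smul_mem_frontier hx)
  have hvp := norm_pos_iff.2 hv0
  have hder : HasDerivAt (fun t : ℝ => (gauge D (x + t • v))⁻¹ • (x + t • v))
      ((gauge D x)⁻¹ • v) 0 := by
    have h1 := hd.hasFDerivAt.hasLineDerivAt v
    rw [← inner_gradient_gauge, hNv, HasLineDerivAt] at h1
    have h2 : HasDerivAt (fun t : ℝ => x + t • v) ((1 : ℝ) • v) 0 :=
      ((hasDerivAt_id (0 : ℝ)).smul_const v).const_add x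
    exact ((h1.inv (by simpa using hg.ne')).smul h2).congr_deriv (by simp)
  have hdne : (gauge D x)⁻¹ • v ≠ 0 := smul_ne_zero (inv_pos.2 hg).ne' hv0
  have hne := hder.eventually_ne (c := (gauge D x)⁻¹ • x) hdne
  have ht := h.tendsto_nhdsWithin_frontier hx hne
  have hlim : Tendsto (fun t : ℝ => segmentAngle ((gauge D (x + t • v))⁻¹ • (x + t • v))
      ((gauge D x)⁻¹ • x)) (𝓝[≠] 0) (𝓝 (Real.arcsin (gauge D x / (‖N‖ * ‖x‖)))) := by
    rw [hasDerivAt_iff_tendsto_slope_zero] at hder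
    simp only [zero_add, zero_smul, add_zero] at hder
    set y := (gauge D x)⁻¹ • x with hy
    have hval : Real.arccos |inner ℝ ((gauge D x)⁻¹ • v) y / (‖(gauge D x)⁻¹ • v‖ * ‖y‖)| =
        Real.arcsin (gauge D x / (‖N‖ * ‖x‖)) := by
      have h1 : |inner ℝ ((gauge D x)⁻¹ • v) y / (‖(gauge D x)⁻¹ • v‖ * ‖y‖)| = ‖v‖ / ‖x‖ := by
        rw [hy, inner_smul_left, inner_smul_right, hvx, norm_smul, norm_smul,
          Real.norm_of_nonneg (inv_pos.2 hg).le, conj_trivial, abs_of_nonneg (by positivity)]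
        field_simp
      rw [h1, Real.arccos_eq_arcsin (by positivity)]
      congr 1
      rw [Real.sqrt_eq_iff_mul_self_eq_of_pos (by positivity), ← sq, div_pow ‖v‖, hvv]
      field_simp
      ring
    rw [← hval]
    have hy0 : y ≠ 0 := smul_ne_zero (inv_pos.2 hg).ne' hx
    refine Tendsto.congr' ?_ ((Real.continuous_arccos.tendsto _).comp
      (((hder.inner (tendsto_const_nhds (x := y))).div (hder.norm.mul_const ‖y‖)
        (mul_pos (norm_pos_iff.2 hdne) (norm_pos_iff.2 hy0)).ne').abs))
    refine eventually_nhdsWithin_of_forall fun t ht => ?_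
    have ht : t ≠ 0 := ht
    simp only [Function.comp, segmentAngle_eq_arccos, Pi.div_apply]
    rw [inner_smul_left, norm_smul, conj_trivial, abs_div, abs_div, abs_mul, mul_assoc, abs_mul,
      Real.norm_eq_abs, abs_abs, mul_div_mul_left _ _ (abs_pos.2 (inv_ne_zero ht)).ne']
  calc tangentAngle D ((gauge D x)⁻¹ • x) ≤ _ :=
        liminf_le_liminf_of_le ht (isBoundedUnder_segmentAngle _ _)
          (isCoboundedUnder_segmentAngle _ _)
    _ = _ := hlim.liminf_eq

/-- At almost every `z` the gradient is normal to a half-space whose boundary passes through `z` and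
which contains `p(z) • x`, so `inner_le_of_inner_nonpos` applies. The factor `p(z)` makes the
inequality homogeneous in `z`, which reduces the boundary to the unit ball. -/
theorem inner_sub_le_of_ae (h : IsPinchedConvex D a b) {q : ℝ} (hq : 0 ≤ q)
    (hae : ∀ᵐ x ∂(volume.restrict (Metric.ball (0 : EuclideanSpace ℝ (Fin n)) 1)),
      q * (‖gradient (gauge D) x‖ * ‖x‖) ≤ gauge D x)
    {z x : EuclideanSpace ℝ (Fin n)} (hz : z ∈ frontier D) (hx : x ∈ frontier D) :
    inner ℝ z (x - z) ≤ √(1 - q ^ 2) * (‖z‖ * ‖x - z‖) := by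
  have hgood : ∀ᵐ z ∂(volume.restrict (Metric.ball (0 : EuclideanSpace ℝ (Fin n)) 1)),
      inner ℝ z (gauge D z • x - z) ≤ √(1 - q ^ 2) * (‖z‖ * ‖gauge D z • x - z‖) := by
    filter_upwards [hae, ae_restrict_of_ae h.ae_differentiableAt_gauge] with z hz1 hz2
    by_cases hz0 : z = 0
    · simp [hz0]
    have hNz : inner ℝ (gradient (gauge D) z) z = gauge D z := by
      rw [inner_gradient_gauge, fderiv_gauge_apply_self hz2]
    refine inner_le_of_inner_nonpos hq ?_ (hNz ▸ hz1) ?_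
    · intro h0
      rw [h0, inner_zero_left] at hNz
      exact (h.gauge_pos hz0).ne hNz
    · rw [inner_sub_right, hNz, inner_gradient_gauge, sub_nonpos]
      refine (h.fderiv_gauge_apply_le hz2 _).trans ?_
      rw [gauge_smul _ (gauge_nonneg _), h.mem_frontier_iff.1 hx, mul_one]
  -- Both sides are continuous in `z`, so the set where the inequality fails is open; being null in
  -- the ball, it misses the ball.
  have hall : ∀ z ∈ Metric.ball (0 : EuclideanSpace ℝ (Fin n)) 1,
      inner ℝ z (gauge D z • x - z) ≤ √(1 - q ^ 2) * (‖z‖ * ‖gauge D z • x - z‖) := by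
    intro z hz
    by_contra hcon
    have hg := h.continuous_gauge
    have hop : IsOpen {z : EuclideanSpace ℝ (Fin n) |
        √(1 - q ^ 2) * (‖z‖ * ‖gauge D z • x - z‖) < inner ℝ z (gauge D z • x - z)} :=
      isOpen_lt (by fun_prop) (by fun_prop)
    have hpos := (hop.inter Metric.isOpen_ball).measure_pos volume ⟨z, not_le.1 hcon, hz⟩
    rw [ae_iff, Measure.restrict_apply₀'
      Metric.isOpen_ball.measurableSet.nullMeasurableSet] at hgood
    simp only [not_le] at hgood
    exact hpos.ne' hgood
  have hz0 := norm_pos_iff.2 (h.ne_zero_of_mem_frontier hz)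
  -- This scaling moves `z` to norm `1/2`, inside the unit ball; both sides scale by `c ^ 2`.
  set c := (2 * ‖z‖)⁻¹ with hc
  have hcp : 0 < c := by positivity
  have h1 := hall (c • z) (by
    rw [mem_ball_zero_iff, norm_smul, Real.norm_of_nonneg hcp.le, hc]
    field_simp
    norm_num)
  rw [gauge_smul _ hcp.le, h.mem_frontier_iff.1 hz, mul_one, ← smul_sub, inner_smul_left,
    inner_smul_right, norm_smul, norm_smul, conj_trivial, Real.norm_of_nonneg hcp.le] at h1
  have hcc : 0 < c * c := by positivity
  nlinarith

/-- The pair inequality based at `y` bounds the cosine from above; based at `z` it bounds it from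
below, but with the direction of `z` in place of that of `y`. The discrepancy tends to zero as `z →
y`. -/
theorem arcsin_le_tangentAngle (h : IsPinchedConvex D a b) (hn : 2 ≤ n) {q : ℝ} (hq : 0 ≤ q)
    (hae : ∀ᵐ x ∂(volume.restrict (Metric.ball (0 : EuclideanSpace ℝ (Fin n)) 1)),
      q * (‖gradient (gauge D) x‖ * ‖x‖) ≤ gauge D x)
    {y : EuclideanSpace ℝ (Fin n)} (hy : y ∈ frontier D) :
    Real.arcsin q ≤ tangentAngle D y := by
  have := h.neBot_nhdsWithin_frontier hn hy
  have hy0 := norm_pos_iff.2 (h.ne_zero_of_mem_frontier hy)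
  have hlim : Tendsto (fun z : EuclideanSpace ℝ (Fin n) =>
      Real.arccos (√(1 - q ^ 2) + ‖‖z‖⁻¹ • z - ‖y‖⁻¹ • y‖)) (𝓝[frontier D \ {y}] y)
      (𝓝 (Real.arcsin q)) := by
    have h1 : Tendsto (fun z : EuclideanSpace ℝ (Fin n) =>
      Real.arccos (√(1 - q ^ 2) + ‖‖z‖⁻¹ • z - ‖y‖⁻¹ • y‖)) (𝓝 y)
      (𝓝 (Real.arccos (√(1 - q ^ 2) + ‖‖y‖⁻¹ • y - ‖y‖⁻¹ • y‖))) :=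
      (Real.continuous_arccos.tendsto _).comp (tendsto_const_nhds.add
        ((((tendsto_id.norm).inv₀ hy0.ne').smul tendsto_id).sub tendsto_const_nhds).norm)
    rw [sub_self, norm_zero, add_zero, ← Real.arcsin_eq_arccos hq] at h1
    exact h1.mono_left inf_le_left
  rw [← hlim.liminf_eq]
  refine liminf_le_liminf ?_ hlim.isBoundedUnder_ge (isCoboundedUnder_segmentAngle _ _)
  refine eventually_nhdsWithin_of_forall fun z hz => ?_
  rw [segmentAngle_eq_arccos]
  apply Real.antitone_arccos
  have hz0 := norm_pos_iff.2 (h.ne_zero_of_mem_frontier hz.1)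
  have hzy : 0 < ‖z - y‖ := norm_pos_iff.2 (sub_ne_zero.2 hz.2)
  have hrw : inner ℝ (z - y) y / (‖z - y‖ * ‖y‖) = inner ℝ (z - y) (‖y‖⁻¹ • y) / ‖z - y‖ := by
    rw [inner_smul_right]
    field_simp
  have h1 : inner ℝ (z - y) (‖y‖⁻¹ • y) ≤ √(1 - q ^ 2) * ‖z - y‖ := by
    have := h.inner_sub_le_of_ae hq hae hy hz.1
    rw [inner_smul_right, real_inner_comm, inv_mul_le_iff₀ hy0]
    linarith
  have h2 : inner ℝ (y - z) (‖z‖⁻¹ • z) ≤ √(1 - q ^ 2) * ‖z - y‖ := by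
    have := h.inner_sub_le_of_ae hq hae hz.1 hy
    rw [inner_smul_right, real_inner_comm, inv_mul_le_iff₀ hz0, norm_sub_rev z y]
    linarith
  have h3 : inner ℝ (z - y) (‖z‖⁻¹ • z - ‖y‖⁻¹ • y) ≤ ‖z - y‖ * ‖‖z‖⁻¹ • z - ‖y‖⁻¹ • y‖ :=
    real_inner_le_norm _ _
  have h4 : inner ℝ (y - z) (‖z‖⁻¹ • z) = - inner ℝ (z - y) (‖z‖⁻¹ • z) := by
    rw [← inner_neg_left, neg_sub]
  rw [inner_sub_right] at h3
  rw [hrw, abs_div, abs_norm, div_le_iff₀ hzy, abs_le]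
  have h5 : 0 ≤ ‖z - y‖ * ‖‖z‖⁻¹ • z - ‖y‖⁻¹ • y‖ := by positivity
  constructor <;> linarith

/-! ### Bounds for the minimal tangent angle -/

theorem nonempty_frontier (h : IsPinchedConvex D a b) (hn : 2 ≤ n) : (frontier D).Nonempty := by
  obtain ⟨v, hv, -⟩ := exists_norm_eq_one_inner_eq_zero hn 0
  exact ⟨_, h.inv_gauge_smul_mem_frontier (norm_pos_iff.1 (hv ▸ one_pos))⟩

theorem arcsin_le_minTangentAngle (h : IsPinchedConvex D a b) (hn : 2 ≤ n) {q : ℝ} (hq : 0 ≤ q)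
    (hae : ∀ᵐ x ∂(volume.restrict (Metric.ball (0 : EuclideanSpace ℝ (Fin n)) 1)),
      q * (‖gradient (gauge D) x‖ * ‖x‖) ≤ gauge D x) :
    Real.arcsin q ≤ minTangentAngle D := by
  have := (h.nonempty_frontier hn).to_subtype
  exact le_ciInf fun y => h.arcsin_le_tangentAngle hn hq hae y.2

/-- Here `|∇p| ≤ 1/a` and `|x| ≤ b p(x)` make `q = a/b` admissible. -/
theorem arcsin_div_le_tangentAngle (h : IsPinchedConvex D a b) (hn : 2 ≤ n)
    {y : EuclideanSpace ℝ (Fin n)} (hy : y ∈ frontier D) :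
    Real.arcsin (a / b) ≤ tangentAngle D y := by
  have hb := h.pos_right
  have ha := h.pos
  refine h.arcsin_le_tangentAngle hn (by positivity) (Eventually.of_forall fun x => ?_) hy
  have h1 := h.mul_norm_fderiv_gauge_le (x := x)
  have h2 := h.norm_le_mul_gauge x
  rw [gradient, LinearIsometryEquiv.norm_map, div_mul_eq_mul_div, div_le_iff₀ hb, ← mul_assoc]
  nlinarith [mul_le_mul_of_nonneg_right h1 (norm_nonneg x)]

theorem minTangentAngle_le (h : IsPinchedConvex D a b) (hn : 2 ≤ n)
    {y : EuclideanSpace ℝ (Fin n)} (hy : y ∈ frontier D) :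
    minTangentAngle D ≤ tangentAngle D y :=
  ciInf_le (f := fun x : frontier D => tangentAngle D x)
    ⟨_, forall_mem_range.2 fun y => h.arcsin_div_le_tangentAngle hn y.2⟩ ⟨y, hy⟩

theorem arcsin_div_le_minTangentAngle (h : IsPinchedConvex D a b) (hn : 2 ≤ n) :
    Real.arcsin (a / b) ≤ minTangentAngle D := by
  have := (h.nonempty_frontier hn).to_subtype
  exact le_ciInf fun y => h.arcsin_div_le_tangentAngle hn y.2

theorem minTangentAngle_pos (h : IsPinchedConvex D a b) (hn : 2 ≤ n) : 0 < minTangentAngle D :=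
  (Real.arcsin_pos.2 (div_pos h.pos h.pos_right)).trans_le (h.arcsin_div_le_minTangentAngle hn)

theorem minTangentAngle_le_pi_div_two (h : IsPinchedConvex D a b) (hn : 2 ≤ n) :
    minTangentAngle D ≤ Real.pi / 2 := by
  obtain ⟨y, hy⟩ := h.nonempty_frontier hn
  exact (h.minTangentAngle_le hn hy).trans (h.tangentAngle_le_pi_div_two hn hy)

theorem isGreatest_minTangentAngle (h : IsPinchedConvex D a b) (hn : 2 ≤ n) :
    IsGreatest {α : ℝ | TangentCondition D α} (minTangentAngle D) := by
  refine ⟨⟨h.minTangentAngle_pos hn, h.minTangentAngle_le_pi_div_two hn,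
    fun x hx => h.minTangentAngle_le hn hx⟩, fun α hα => ?_⟩
  have := (h.nonempty_frontier hn).to_subtype
  exact le_ciInf fun y => hα.2.2 y y.2

theorem sin_minTangentAngle_pos (h : IsPinchedConvex D a b) (hn : 2 ≤ n) :
    0 < Real.sin (minTangentAngle D) :=
  Real.sin_pos_of_pos_of_lt_pi (h.minTangentAngle_pos hn)
    ((h.minTangentAngle_le_pi_div_two hn).trans_lt (by linarith [Real.pi_pos]))

theorem norm_gradient_gauge_mul_le (h : IsPinchedConvex D a b) (hn : 2 ≤ n)
    {x : EuclideanSpace ℝ (Fin n)} (hx : x ≠ 0) (hd : DifferentiableAt ℝ (gauge D) x) :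
    Real.sin (minTangentAngle D) * (‖gradient (gauge D) x‖ * ‖x‖) ≤ gauge D x := by
  have h1 := (h.minTangentAngle_le hn (h.inv_gauge_smul_mem_frontier hx)).trans
    (h.tangentAngle_le_arcsin hn hx hd)
  have hk := gauge_le_norm_gradient_mul hd
  have hkp := (h.gauge_pos hx).trans_le hk
  have hg := h.gauge_pos hx
  have h2 := (Real.le_arcsin_iff_sin_le ⟨by linarith [h.minTangentAngle_pos hn, Real.pi_pos],
    h.minTangentAngle_le_pi_div_two hn⟩ ⟨by
      have : 0 ≤ gauge D x / (‖gradient (gauge D) x‖ * ‖x‖) := by positivity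
      linarith, div_le_one_of_le₀ hk hkp.le⟩).1 h1
  rwa [le_div_iff₀ hkp] at h2

end IsPinchedConvex

/-! ### Stretches of linear maps -/

section Stretch

variable {n : ℕ} (A : EuclideanSpace ℝ (Fin n) →L[ℝ] EuclideanSpace ℝ (Fin n))

theorem norm_apply_le_maxStretch_mul (h : EuclideanSpace ℝ (Fin n)) :
    ‖A h‖ ≤ maxStretch A * ‖h‖ := by
  by_cases h0 : h = 0
  · simp [h0]
  have hp := norm_pos_iff.2 h0
  have hb : BddAbove ((fun h => ‖A h‖) '' Metric.sphere 0 1) := by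
    refine ⟨‖A‖, ?_⟩
    rintro _ ⟨u, hu, rfl⟩
    simpa [mem_sphere_zero_iff_norm.1 hu] using A.le_opNorm u
  have h1 := le_csSup hb ⟨‖h‖⁻¹ • h, mem_sphere_zero_iff_norm.2 (norm_smul_inv_norm h0), rfl⟩
  simp only [map_smul, norm_smul, norm_inv, norm_norm] at h1
  rwa [inv_mul_le_iff₀ hp, mul_comm] at h1

theorem minStretch_mul_le_norm_apply (h : EuclideanSpace ℝ (Fin n)) :
    minStretch A * ‖h‖ ≤ ‖A h‖ := by
  by_cases h0 : h = 0
  · simp [h0]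
  have hp := norm_pos_iff.2 h0
  have hb : BddBelow ((fun h => ‖A h‖) '' Metric.sphere 0 1) := by
    refine ⟨0, ?_⟩
    rintro _ ⟨u, hu, rfl⟩
    exact norm_nonneg _
  have h1 := csInf_le hb ⟨‖h‖⁻¹ • h, mem_sphere_zero_iff_norm.2 (norm_smul_inv_norm h0), rfl⟩
  simp only [map_smul, norm_smul, norm_inv, norm_norm] at h1
  rw [inv_mul_eq_div, le_div_iff₀ hp] at h1
  exact h1

theorem nonempty_image_sphere (hn : 2 ≤ n) :
    ((fun h => ‖A h‖) '' Metric.sphere (0 : EuclideanSpace ℝ (Fin n)) 1).Nonempty := by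
  obtain ⟨v, hv, -⟩ := exists_norm_eq_one_inner_eq_zero hn 0
  exact ⟨_, v, mem_sphere_zero_iff_norm.2 hv, rfl⟩

variable {A}

theorem maxStretch_le (hn : 2 ≤ n) {M : ℝ} (hM : ∀ h, ‖A h‖ ≤ M * ‖h‖) : maxStretch A ≤ M := by
  refine csSup_le (nonempty_image_sphere A hn) ?_
  rintro _ ⟨u, hu, rfl⟩
  simpa [mem_sphere_zero_iff_norm.1 hu] using hM u

theorem le_minStretch (hn : 2 ≤ n) {M : ℝ} (hM : ∀ h, M * ‖h‖ ≤ ‖A h‖) : M ≤ minStretch A := by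
  refine le_csInf (nonempty_image_sphere A hn) ?_
  rintro _ ⟨u, hu, rfl⟩
  simpa [mem_sphere_zero_iff_norm.1 hu] using hM u

end Stretch

/-! ### Derivatives of radial maps -/

/-- Here `p` and `R` are the sizes of the components of a vector along and across `e`, and `r` is
its product with `N - e`. In the extreme case `|r| = T R` the form has trace `2 s²` and determinant
`s²`, hence eigenvalues `s (s ± T)`. -/
theorem model_upper {s T p R r : ℝ} (hs : 0 ≤ s) (hT : 0 ≤ T) (hsT : s ^ 2 = 1 + T ^ 2)
    (hr : |r| ≤ T * R) :
    R ^ 2 + (s * p - r) ^ 2 ≤ s * (s + T) * (R ^ 2 + p ^ 2) := by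
  have h1 : -(p * r) ≤ |p| * (T * R) := by
    calc -(p * r) ≤ |p * r| := neg_le_abs _
      _ = |p| * |r| := abs_mul _ _
      _ ≤ _ := by gcongr
  have h2 : r ^ 2 ≤ (T * R) ^ 2 := by
    rw [← sq_abs r]
    gcongr
  have h3 : 2 * |p| * R ≤ p ^ 2 + R ^ 2 := by
    rw [← sq_abs p]
    nlinarith [sq_nonneg (|p| - R)]
  have h4 := mul_le_mul_of_nonneg_left h1 hs
  have h5 := mul_le_mul_of_nonneg_left h3 (mul_nonneg hs hT)
  nlinarith

theorem model_lower {s T p R r : ℝ} (hs : 0 ≤ s) (hT : 0 ≤ T) (hsT : s ^ 2 = 1 + T ^ 2)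
    (hr : |r| ≤ T * R) :
    s * (s - T) * (R ^ 2 + p ^ 2) ≤ R ^ 2 + (s * p - r) ^ 2 := by
  have h2 : r ^ 2 ≤ (T * R) ^ 2 := by
    rw [← sq_abs r]
    gcongr
  rcases hT.eq_or_lt with rfl | hT
  · have hr0 : r = 0 := by simpa using hr
    subst hr0
    nlinarith [sq_nonneg p, sq_nonneg R]
  · have hTs : 0 ≤ s - T := by
      by_contra hcon
      nlinarith
    -- A decomposition into nonnegative terms; the last one vanishes by `hsT`.
    have key : T * (R ^ 2 + (s * p - r) ^ 2 - s * (s - T) * (R ^ 2 + p ^ 2)) =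
        s * (T * p - r) ^ 2 + (s - T) * ((T * R) ^ 2 - r ^ 2) +
          T * (1 + T ^ 2 - s ^ 2) * R ^ 2 := by
      ring
    have h3 : 0 ≤ T * (R ^ 2 + (s * p - r) ^ 2 - s * (s - T) * (R ^ 2 + p ^ 2)) := by
      rw [key, ← hsT, sub_self, mul_zero, zero_mul, add_zero]
      exact add_nonneg (mul_nonneg hs (sq_nonneg _)) (mul_nonneg hTs (sub_nonneg.2 h2))
    linarith [nonneg_of_mul_nonneg_right h3 hT]

/-- The form has trace `s² + t² + 1` and determinant `s²`. Its characteristic polynomial is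
nonnegative at `l²` and at `M²`, by the discriminants. One of these two numbers lies in `[s/K, K
s]`, where `P + s²/P ≤ s (K + 1/K)`. -/
theorem model_dilatation_le {s t l M K : ℝ} (hs : 1 ≤ s) (hl : 0 < l) (hM : 0 ≤ M) (hK : 1 ≤ K)
    (hMl : M ≤ K * l)
    (h1 : ∀ x y : ℝ, l ^ 2 * (x ^ 2 + y ^ 2) ≤ (s * x - t * y) ^ 2 + y ^ 2)
    (h2 : ∀ x y : ℝ, (s * x - t * y) ^ 2 + y ^ 2 ≤ M ^ 2 * (x ^ 2 + y ^ 2)) :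
    K * (s ^ 2 + t ^ 2 + 1) ≤ s * (K ^ 2 + 1) := by
  have hM2 : s ^ 2 ≤ M ^ 2 := by simpa using h2 1 0
  have hl2 : l ^ 2 ≤ 1 := by
    have := h1 t s
    have hs2 : s ^ 2 ≤ t ^ 2 + s ^ 2 := by nlinarith [sq_nonneg t]
    have hp : 0 < t ^ 2 + s ^ 2 := by positivity
    by_contra hcon
    nlinarith
  have hMl2 : M ^ 2 ≤ K ^ 2 * l ^ 2 := by
    rw [← mul_pow]
    gcongr
  have a1 : l ^ 2 * (s ^ 2 + t ^ 2 + 1) ≤ s ^ 2 + (l ^ 2) ^ 2 := by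
    have := discrim_le_zero (a := s ^ 2 - l ^ 2) (b := -(2 * s * t)) (c := t ^ 2 + 1 - l ^ 2)
      fun x => by linarith [h1 x 1]
    rw [discrim] at this
    nlinarith
  have a2 : M ^ 2 * (s ^ 2 + t ^ 2 + 1) ≤ s ^ 2 + (M ^ 2) ^ 2 := by
    have := discrim_le_zero (a := M ^ 2 - s ^ 2) (b := 2 * s * t) (c := M ^ 2 - (t ^ 2 + 1))
      fun x => by linarith [h2 x 1]
    rw [discrim] at this
    nlinarith
  have key : ∀ P : ℝ, 0 < P → P * (s ^ 2 + t ^ 2 + 1) ≤ s ^ 2 + P ^ 2 → P ≤ K * s → s ≤ K * P →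
      K * (s ^ 2 + t ^ 2 + 1) ≤ s * (K ^ 2 + 1) := by
    intro P hP h3 h4 h5
    have h6 := mul_nonneg (sub_nonneg.2 h4) (sub_nonneg.2 h5)
    have h7 := mul_le_mul_of_nonneg_left h3 (zero_le_one.trans hK)
    have h8 : P * (K * (s ^ 2 + t ^ 2 + 1)) ≤ P * (s * (K ^ 2 + 1)) := by linarith
    exact le_of_mul_le_mul_left h8 hP
  have hss : s ≤ s ^ 2 := by nlinarith
  rcases le_total (M ^ 2) (K * s) with h3 | h3
  · exact key _ (by nlinarith) a2 h3 (by nlinarith)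
  · refine key _ (by positivity) a1 (by nlinarith) ?_
    have : K * s ≤ K * (K * l ^ 2) := by linarith
    exact le_of_mul_le_mul_left this (by linarith)

/-- `A` is `ρ (1 + ⟨s e - N, ·⟩ e)` with `|e| = 1`, `⟨N, e⟩ = 1`: the shape of the derivative of
a radial extension. -/
structure IsRadialDerivative {n : ℕ}
    (A : EuclideanSpace ℝ (Fin n) →L[ℝ] EuclideanSpace ℝ (Fin n)) (ρ s : ℝ)
    (e N : EuclideanSpace ℝ (Fin n)) : Prop where
  apply_eq : ∀ h, A h = ρ • (h + inner ℝ (s • e - N) h • e)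
  scale_pos : 0 < ρ
  one_le : 1 ≤ s
  norm_eq_one : ‖e‖ = 1
  inner_eq_one : inner ℝ N e = 1

/-! ### Determinant and stretches of the radial derivative -/

namespace IsRadialDerivative

variable {n : ℕ} {A : EuclideanSpace ℝ (Fin n) →L[ℝ] EuclideanSpace ℝ (Fin n)} {ρ s : ℝ}
  {e N : EuclideanSpace ℝ (Fin n)}

theorem det_eq (h : IsRadialDerivative A ρ s e N) : A.det = ρ ^ n * s := by
  have h1 : (A : EuclideanSpace ℝ (Fin n) →ₗ[ℝ] EuclideanSpace ℝ (Fin n)) =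
      ρ • LinearMap.transvection (innerₛₗ ℝ (s • e - N)) e := by
    ext1 v
    simp [LinearMap.transvection.apply, h.apply_eq, inner_sub_left, inner_smul_left]
  rw [ContinuousLinearMap.det, h1, LinearMap.det_smul, LinearMap.transvection.det,
    finrank_euclideanSpace, Fintype.card_fin]
  congr 1
  rw [innerₛₗ_apply_apply, inner_sub_left, inner_smul_left, h.inner_eq_one,
    real_inner_self_eq_norm_sq, h.norm_eq_one]
  simp

theorem det_pos (h : IsRadialDerivative A ρ s e N) : 0 < A.det := by
  rw [h.det_eq]
  have := h.one_le
  have := h.scale_pos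
  positivity

theorem norm_apply_sq (h : IsRadialDerivative A ρ s e N) (v : EuclideanSpace ℝ (Fin n)) :
    ‖A v‖ ^ 2 = ρ ^ 2 * (‖v - inner ℝ e v • e‖ ^ 2 + (s * inner ℝ e v - inner ℝ (N - e) v) ^ 2) := by
  rw [h.apply_eq, norm_smul, mul_pow, Real.norm_eq_abs, sq_abs]
  congr 1
  rw [norm_add_sq_real, norm_sub_sq_real, inner_smul_right, inner_smul_right, norm_smul, norm_smul,
    mul_pow, mul_pow, Real.norm_eq_abs, Real.norm_eq_abs, sq_abs, sq_abs, h.norm_eq_one,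
    real_inner_comm e v, inner_sub_left, inner_sub_left, inner_smul_left, conj_trivial]
  ring

theorem norm_sq_eq (h : IsRadialDerivative A ρ s e N) (v : EuclideanSpace ℝ (Fin n)) :
    ‖v‖ ^ 2 = ‖v - inner ℝ e v • e‖ ^ 2 + inner ℝ e v ^ 2 := by
  rw [norm_sub_sq_real, inner_smul_right, norm_smul, mul_pow, Real.norm_eq_abs, sq_abs,
    h.norm_eq_one, real_inner_comm e v]
  ring

theorem norm_sub_sq (h : IsRadialDerivative A ρ s e N) : ‖N - e‖ ^ 2 = ‖N‖ ^ 2 - 1 := by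
  rw [norm_sub_sq_real, h.inner_eq_one, h.norm_eq_one]
  ring

theorem abs_inner_le (h : IsRadialDerivative A ρ s e N) (v : EuclideanSpace ℝ (Fin n)) :
    |inner ℝ (N - e) v| ≤ ‖N - e‖ * ‖v - inner ℝ e v • e‖ := by
  have h1 : inner ℝ (N - e) v = inner ℝ (N - e) (v - inner ℝ e v • e) := by
    rw [inner_sub_right, inner_smul_right, inner_sub_left N e e, h.inner_eq_one,
      real_inner_self_eq_norm_sq, h.norm_eq_one]
    ring
  rw [h1]
  exact abs_real_inner_le_norm _ _

theorem sq_sqrt (h : IsRadialDerivative A ρ s e N) : √(s ^ 2 - 1) ^ 2 = s ^ 2 - 1 :=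
  Real.sq_sqrt (by nlinarith [h.one_le])

theorem sqrt_lt (h : IsRadialDerivative A ρ s e N) : √(s ^ 2 - 1) < s :=
  (Real.sqrt_lt' (by linarith [h.one_le])).2 (by linarith)

theorem norm_sub_le (h : IsRadialDerivative A ρ s e N) (hN : ‖N‖ ≤ s) :
    ‖N - e‖ ≤ √(s ^ 2 - 1) := by
  apply Real.le_sqrt_of_sq_le
  rw [h.norm_sub_sq]
  gcongr

theorem maxStretch_le_sqrt (h : IsRadialDerivative A ρ s e N) (hn : 2 ≤ n) (hN : ‖N‖ ≤ s) :
    maxStretch A ≤ ρ * √(s * (s + √(s ^ 2 - 1))) := by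
  have hs := h.one_le
  have hρ := h.scale_pos
  refine maxStretch_le hn fun v => ?_
  refine (pow_le_pow_iff_left₀ (norm_nonneg _) (by positivity) two_ne_zero).1 ?_
  rw [mul_pow, mul_pow, Real.sq_sqrt (by positivity), h.norm_apply_sq, mul_assoc]
  refine mul_le_mul_of_nonneg_left ?_ (by positivity)
  rw [h.norm_sq_eq v]
  refine model_upper (by linarith) (Real.sqrt_nonneg _) (by rw [h.sq_sqrt]; ring)
    ((h.abs_inner_le v).trans ?_)
  gcongr
  exact h.norm_sub_le hN

theorem sqrt_le_minStretch (h : IsRadialDerivative A ρ s e N) (hn : 2 ≤ n) (hN : ‖N‖ ≤ s) :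
    ρ * √(s * (s - √(s ^ 2 - 1))) ≤ minStretch A := by
  have hs := h.one_le
  have hρ := h.scale_pos
  refine le_minStretch hn fun v => ?_
  refine (pow_le_pow_iff_left₀ (by positivity) (norm_nonneg _) two_ne_zero).1 ?_
  rw [mul_pow, mul_pow, Real.sq_sqrt (mul_nonneg (by linarith) (by linarith [h.sqrt_lt])),
    h.norm_apply_sq, mul_assoc]
  refine mul_le_mul_of_nonneg_left ?_ (by positivity)
  rw [h.norm_sq_eq v]
  refine model_lower (by linarith) (Real.sqrt_nonneg _) (by rw [h.sq_sqrt]; ring)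
    ((h.abs_inner_le v).trans ?_)
  gcongr
  exact h.norm_sub_le hN

theorem minStretch_pos (h : IsRadialDerivative A ρ s e N) (hn : 2 ≤ n) (hN : ‖N‖ ≤ s) :
    0 < minStretch A := by
  refine lt_of_lt_of_le ?_ (h.sqrt_le_minStretch hn hN)
  exact mul_pos h.scale_pos (Real.sqrt_pos.2 (mul_pos (by linarith [h.one_le])
    (by linarith [h.sqrt_lt])))

theorem maxStretch_le_mul_minStretch (h : IsRadialDerivative A ρ s e N) (hn : 2 ≤ n)
    (hN : ‖N‖ ≤ s) : maxStretch A ≤ (s + √(s ^ 2 - 1)) * minStretch A := by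
  have hs := h.one_le
  have hT := Real.sqrt_nonneg (s ^ 2 - 1)
  refine (h.maxStretch_le_sqrt hn hN).trans (le_trans (le_of_eq ?_)
    (mul_le_mul_of_nonneg_left (h.sqrt_le_minStretch hn hN) (by positivity)))
  -- This rests on `(s + √(s² - 1)) (s - √(s² - 1)) = 1`.
  have h1 : s * (s + √(s ^ 2 - 1)) = (s + √(s ^ 2 - 1)) ^ 2 * (s * (s - √(s ^ 2 - 1))) := by
    linear_combination (s * (s + √(s ^ 2 - 1))) * h.sq_sqrt
  rw [h1, Real.sqrt_mul (sq_nonneg _), Real.sqrt_sq (by positivity)]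
  ring

theorem scale_mul_le_maxStretch (h : IsRadialDerivative A ρ s e N) : ρ * s ≤ maxStretch A := by
  have h1 := norm_apply_le_maxStretch_mul A e
  rw [h.norm_eq_one, mul_one] at h1
  refine le_trans (le_of_eq ?_) h1
  refine (pow_left_inj₀ (mul_nonneg h.scale_pos.le (by linarith [h.one_le])) (norm_nonneg _)
    two_ne_zero).1 ?_
  rw [h.norm_apply_sq, inner_sub_left, h.inner_eq_one, real_inner_self_eq_norm_sq, h.norm_eq_one]
  simp
  ring

theorem exists_frame (h : IsRadialDerivative A ρ s e N) (hn : 2 ≤ n) :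
    ∃ w : EuclideanSpace ℝ (Fin n), ‖w‖ = 1 ∧ inner ℝ e w = 0 ∧ N - e = ‖N - e‖ • w := by
  by_cases h0 : N - e = 0
  · obtain ⟨w, hw, hw'⟩ := exists_norm_eq_one_inner_eq_zero hn e
    exact ⟨w, hw, hw', by simp [h0]⟩
  · refine ⟨‖N - e‖⁻¹ • (N - e), norm_smul_inv_norm h0, ?_, ?_⟩
    · rw [inner_smul_right, inner_sub_right, real_inner_comm, h.inner_eq_one,
        real_inner_self_eq_norm_sq, h.norm_eq_one]
      simp
    · rw [smul_smul, mul_inv_cancel₀ (norm_ne_zero_iff.2 h0), one_smul]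

/-- On a plane containing `e` and `N - e` the map is `ρ` times the matrix with rows `(s, -|N - e|)`
and `(0, 1)`. -/
theorem exists_plane (h : IsRadialDerivative A ρ s e N) (hn : 2 ≤ n) (x y : ℝ) :
    ∃ v : EuclideanSpace ℝ (Fin n), ‖v‖ ^ 2 = x ^ 2 + y ^ 2 ∧
      ‖A v‖ ^ 2 = ρ ^ 2 * ((s * x - ‖N - e‖ * y) ^ 2 + y ^ 2) := by
  obtain ⟨w, hw, hew, hNw⟩ := h.exists_frame hn
  have h1 : inner ℝ e (x • e + y • w) = x := by
    rw [inner_add_right, inner_smul_right, inner_smul_right, hew, real_inner_self_eq_norm_sq,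
      h.norm_eq_one]
    ring
  have h2 : inner ℝ (N - e) (x • e + y • w) = ‖N - e‖ * y := by
    rw [hNw, inner_smul_left, inner_add_right, inner_smul_right, inner_smul_right,
      real_inner_comm, hew, real_inner_self_eq_norm_sq, hw, norm_smul, hw]
    simp
  have h3 : x • e + y • w - x • e = y • w := add_sub_cancel_left _ _
  refine ⟨x • e + y • w, ?_, ?_⟩
  · rw [h.norm_sq_eq, h1, h3, norm_smul, hw, mul_one, Real.norm_eq_abs, sq_abs, add_comm]
  · rw [h.norm_apply_sq, h1, h2, h3, norm_smul, hw, mul_one, Real.norm_eq_abs, sq_abs, add_comm]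

theorem minStretch_le_scale (h : IsRadialDerivative A ρ s e N) (hn : 2 ≤ n) :
    minStretch A ≤ ρ := by
  -- The coordinates are chosen to kill the component of `A v` along `e`.
  obtain ⟨v, hv, hAv⟩ := h.exists_plane hn ‖N - e‖ s
  have hρ := h.scale_pos
  have hs := h.one_le
  have h1 : ‖A v‖ ^ 2 ≤ (ρ * ‖v‖) ^ 2 := by
    rw [hAv, mul_pow, hv]
    refine mul_le_mul_of_nonneg_left ?_ (by positivity)
    nlinarith [sq_nonneg ‖N - e‖]
  have h2 : ‖A v‖ ≤ ρ * ‖v‖ :=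
    (pow_le_pow_iff_left₀ (norm_nonneg _) (by positivity) two_ne_zero).1 h1
  have hvp : 0 < ‖v‖ := by
    refine (norm_nonneg v).lt_of_ne fun h0 => ?_
    rw [← h0] at hv
    nlinarith [sq_nonneg ‖N - e‖]
  exact le_of_mul_le_mul_right ((minStretch_mul_le_norm_apply A v).trans h2) hvp

/-- The determinant is `ρ ^ n * s`, and `λ ≤ ρ ≤ ρ s ≤ Λ ≤ (s + √(s² - 1)) λ` compares `ρ` with both
stretches. -/
theorem quasiconformal_bounds (h : IsRadialDerivative A ρ s e N) (hn : 2 ≤ n) (hN : ‖N‖ ≤ s) :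
    maxStretch A ^ n / (s * (s + √(s ^ 2 - 1)) ^ n) ≤ |A.det| ∧
      |A.det| ≤ s * (s + √(s ^ 2 - 1)) ^ n * minStretch A ^ n := by
  have hs := h.one_le
  have hρ := h.scale_pos
  have hT := Real.sqrt_nonneg (s ^ 2 - 1)
  have h1 := h.maxStretch_le_mul_minStretch hn hN
  have h2 := h.minStretch_le_scale hn
  have h3 := h.scale_mul_le_maxStretch
  have h4 : ρ ≤ ρ * s := le_mul_of_one_le_right hρ.le hs
  set K := s + √(s ^ 2 - 1) with hK
  have hKp : 0 < K := by positivity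
  rw [abs_of_pos h.det_pos, h.det_eq]
  constructor
  · rw [div_le_iff₀ (by positivity)]
    have h5 : maxStretch A ≤ K * ρ := h1.trans (by gcongr)
    calc maxStretch A ^ n ≤ (K * ρ) ^ n :=
          pow_le_pow_left₀ ((mul_nonneg hρ.le (by linarith)).trans h3) h5 n
      _ = ρ ^ n * 1 * (1 * K ^ n) := by rw [mul_pow]; ring
      _ ≤ ρ ^ n * s * (s * K ^ n) := by gcongr
  · have h5 : ρ ≤ K * minStretch A := h4.trans (h3.trans h1)
    calc ρ ^ n * s ≤ (K * minStretch A) ^ n * s := by gcongr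
      _ = _ := by rw [mul_pow]; ring

theorem linearDilatation_eq (h : IsRadialDerivative A ρ s e N) :
    linearDilatation A = ENNReal.ofReal (maxStretch A / minStretch A) :=
  if_neg h.det_pos.ne'

theorem linearDilatation_le (h : IsRadialDerivative A ρ s e N) (hn : 2 ≤ n) (hN : ‖N‖ ≤ s) :
    linearDilatation A ≤ ENNReal.ofReal (s + √(s ^ 2 - 1)) := by
  rw [h.linearDilatation_eq]
  apply ENNReal.ofReal_le_ofReal
  rw [div_le_iff₀ (h.minStretch_pos hn hN)]
  exact h.maxStretch_le_mul_minStretch hn hN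

theorem one_le_linearDilatation (h : IsRadialDerivative A ρ s e N) (hn : 2 ≤ n) (hN : ‖N‖ ≤ s) :
    1 ≤ linearDilatation A := by
  rw [h.linearDilatation_eq, ENNReal.one_le_ofReal, one_le_div (h.minStretch_pos hn hN)]
  exact (h.minStretch_le_scale hn).trans ((le_mul_of_one_le_right h.scale_pos.le h.one_le).trans
    h.scale_mul_le_maxStretch)

theorem mul_norm_sq_le (h : IsRadialDerivative A ρ s e N) (hn : 2 ≤ n) (hN : ‖N‖ ≤ s) {K : ℝ}
    (hK : 1 ≤ K) (hle : linearDilatation A ≤ ENNReal.ofReal K) :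
    K * (s ^ 2 + ‖N‖ ^ 2) ≤ s * (K ^ 2 + 1) := by
  have hm := h.minStretch_pos hn hN
  have hρ := h.scale_pos
  rw [h.linearDilatation_eq, ENNReal.ofReal_le_ofReal_iff (by linarith), div_le_iff₀ hm] at hle
  have hM : 0 ≤ maxStretch A :=
    (mul_nonneg hρ.le (by linarith [h.one_le])).trans h.scale_mul_le_maxStretch
  have := model_dilatation_le (s := s) (t := ‖N - e‖) (l := minStretch A / ρ)
    (M := maxStretch A / ρ) (K := K) h.one_le (by positivity) (by positivity) hK
    (by rw [← mul_div_assoc]; gcongr) ?_ ?_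
  · rw [h.norm_sub_sq] at this
    linarith
  · intro x y
    obtain ⟨v, hv, hAv⟩ := h.exists_plane hn x y
    have h1 := pow_le_pow_left₀ (by positivity) (minStretch_mul_le_norm_apply A v) 2
    rw [mul_pow, hAv, hv] at h1
    rw [div_pow, div_mul_eq_mul_div, div_le_iff₀ (by positivity)]
    linarith
  · intro x y
    obtain ⟨v, hv, hAv⟩ := h.exists_plane hn x y
    have h1 := pow_le_pow_left₀ (by positivity) (norm_apply_le_maxStretch_mul A v) 2
    rw [mul_pow, hAv, hv] at h1
    rw [div_pow, div_mul_eq_mul_div, le_div_iff₀ (by positivity)]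
    linarith

end IsRadialDerivative

/-! ### Radial extensions: Lipschitz bound, homeomorphism, derivative -/

theorem abs_rpow_sub_rpow_le {s r t : ℝ} (hs : 1 ≤ s) (hr : r ∈ Icc (0 : ℝ) 1)
    (ht : t ∈ Icc (0 : ℝ) 1) : |r ^ s - t ^ s| ≤ s * |r - t| := by
  refine Convex.norm_image_sub_le_of_norm_hasDerivWithin_le (f := fun r : ℝ => r ^ s)
    (fun x _ => (Real.hasDerivAt_rpow_const (Or.inr hs)).hasDerivWithinAt) (fun x hx => ?_)
    (convex_Icc 0 1) ht hr
  rw [Real.norm_of_nonneg (mul_nonneg (by linarith) (Real.rpow_nonneg hx.1 _))]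
  exact mul_le_of_le_one_right (by linarith) (Real.rpow_le_one hx.1 hx.2 (by linarith))

theorem insertCoord_sub {n : ℕ} (k : Fin n) (t t' : ℝ) (y : {i : Fin n // i ≠ k} → ℝ) :
    insertCoord k t y - insertCoord k t' y = EuclideanSpace.single k (t - t') := by
  ext i
  by_cases hi : i = k <;> simp [insertCoord, hi]

theorem LipschitzOnWith.isACL {n : ℕ} {f : EuclideanSpace ℝ (Fin n) → EuclideanSpace ℝ (Fin n)}
    {U : Set (EuclideanSpace ℝ (Fin n))} {C : NNReal} (h : LipschitzOnWith C f U) : IsACL f U := by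
  refine ⟨h.continuousOn, fun p q hpq hbox k => Eventually.of_forall fun y hy => ?_⟩
  refine LipschitzOnWith.absolutelyContinuousOnInterval (K := C) ?_
  rw [uIcc_of_le (hpq k).le]
  have hmem : ∀ t ∈ Icc (p k) (q k), insertCoord k t y ∈ U := by
    refine fun t ht => hbox fun i => ?_
    by_cases hi : i = k
    · subst hi
      simpa [insertCoord] using ht
    · simpa [insertCoord, hi] using hy ⟨i, hi⟩
  refine LipschitzOnWith.of_dist_le_mul fun t ht t' ht' => ?_
  refine (h.dist_le_mul _ (hmem t ht) _ (hmem t' ht')).trans_eq ?_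
  rw [dist_eq_norm (insertCoord k t y), insertCoord_sub, PiLp.norm_single, dist_eq_norm]

namespace IsPinchedConvex

variable {n : ℕ} {D : Set (EuclideanSpace ℝ (Fin n))} {a b s : ℝ}

theorem norm_radialExtension_le (h : IsPinchedConvex D a b) (hs : 1 ≤ s)
    {x : EuclideanSpace ℝ (Fin n)} (hx : ‖x‖ ≤ 1) : ‖radialExtension D s x‖ ≤ b * ‖x‖ := by
  refine (h.norm_le_mul_gauge _).trans (mul_le_mul_of_nonneg_left ?_ h.pos_right.le)
  rw [h.gauge_radialExtension (by linarith)]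
  simpa using Real.rpow_le_rpow_of_exponent_ge' (norm_nonneg x) hx zero_le_one hs

theorem norm_radialExtension_sub_le (h : IsPinchedConvex D a b) (hs : 1 ≤ s)
    {x y : EuclideanSpace ℝ (Fin n)} (hx : ‖x‖ ≤ 1) (hy : ‖y‖ ≤ 1) :
    ‖radialExtension D s x - radialExtension D s y‖ ≤ (b + b * (b / a) + s * b) * ‖x - y‖ := by
  have ha := h.pos
  have hb := h.pos_right
  have hC : b ≤ b + b * (b / a) + s * b := by
    have : 0 ≤ b * (b / a) + s * b := by positivity
    linarith
  have hzero : radialExtension D s 0 = 0 := if_pos rfl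
  by_cases hx0 : x = 0
  · rw [hx0, hzero, zero_sub, zero_sub, norm_neg, norm_neg]
    exact (h.norm_radialExtension_le hs hy).trans (by gcongr)
  by_cases hy0 : y = 0
  · rw [hy0, hzero, sub_zero, sub_zero]
    exact (h.norm_radialExtension_le hs hx).trans (by gcongr)
  have hgx := h.gauge_pos hx0
  have hgy := h.gauge_pos hy0
  have hcx : ‖x‖ ^ s * (gauge D x)⁻¹ ≤ b := by
    rw [← div_eq_mul_inv, div_le_iff₀ hgx]
    refine le_trans ?_ (h.norm_le_mul_gauge x)
    simpa using Real.rpow_le_rpow_of_exponent_ge' (norm_nonneg x) hx zero_le_one hs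
  have hcy : (gauge D y)⁻¹ * ‖y‖ ≤ b := by
    rw [inv_mul_le_iff₀ hgy, mul_comm]
    exact h.norm_le_mul_gauge y
  have hg : |gauge D y - gauge D x| ≤ ‖x - y‖ / a := by
    rw [le_div_iff₀ ha, mul_comm, norm_sub_rev]
    exact h.gauge_sub_le y x
  have hr : |‖x‖ ^ s - ‖y‖ ^ s| ≤ s * ‖x - y‖ :=
    (abs_rpow_sub_rpow_le hs ⟨norm_nonneg x, hx⟩ ⟨norm_nonneg y, hy⟩).trans
      (mul_le_mul_of_nonneg_left (abs_norm_sub_norm_le x y) (by linarith))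
  -- Telescoping: the vector, the gauge and the power of the norm are changed one at a time.
  have hid : radialExtension D s x - radialExtension D s y =
      (‖x‖ ^ s * (gauge D x)⁻¹) • (x - y) +
      ((‖x‖ ^ s * (gauge D x)⁻¹) * (gauge D y - gauge D x)) • ((gauge D y)⁻¹ • y) +
      (‖x‖ ^ s - ‖y‖ ^ s) • ((gauge D y)⁻¹ • y) := by
    have h1 : ‖x‖ ^ s * (gauge D x)⁻¹ * (gauge D y - gauge D x) * (gauge D y)⁻¹ =
        ‖x‖ ^ s * (gauge D x)⁻¹ - ‖x‖ ^ s * (gauge D y)⁻¹ := by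
      field_simp
    rw [h.radialExtension_eq, h.radialExtension_eq, smul_smul, smul_smul, h1]
    module
  have hny : ‖(gauge D y)⁻¹ • y‖ ≤ b := by
    rwa [norm_smul, Real.norm_of_nonneg (inv_pos.2 hgy).le]
  have hc0 : 0 ≤ ‖x‖ ^ s * (gauge D x)⁻¹ := by positivity
  rw [hid]
  refine (norm_add₃_le).trans ?_
  rw [norm_smul _ (x - y), norm_smul _ ((gauge D y)⁻¹ • y), norm_smul _ ((gauge D y)⁻¹ • y),
    Real.norm_of_nonneg hc0, Real.norm_eq_abs, Real.norm_eq_abs, abs_mul, abs_of_nonneg hc0]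
  calc _ ≤ b * ‖x - y‖ + b * (‖x - y‖ / a) * b + s * ‖x - y‖ * b := by gcongr
    _ = _ := by ring

theorem lipschitzOnWith_radialExtension (h : IsPinchedConvex D a b) (hs : 1 ≤ s) :
    ∃ C : NNReal, LipschitzOnWith C (radialExtension D s) (Metric.ball 0 1) := by
  have ha := h.pos
  have hb := h.pos_right
  refine ⟨⟨b + b * (b / a) + s * b, by positivity⟩, LipschitzOnWith.of_dist_le_mul
    fun x hx y hy => ?_⟩
  rw [dist_eq_norm, dist_eq_norm]
  exact h.norm_radialExtension_sub_le hs (mem_ball_zero_iff.1 hx).le (mem_ball_zero_iff.1 hy).le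

theorem isHomeoOnto_radialExtension (h : IsPinchedConvex D a b) (hs : 1 ≤ s) :
    IsHomeoOnto (radialExtension D s) (Metric.ball 0 1) D := by
  have hs0 : 0 < s := by linarith
  have hzero : radialExtension D s 0 = 0 := if_pos rfl
  -- The inverse: the gauge of the image of `x` is `|x|^s`, which recovers `|x|`, and directions are
  -- preserved.
  set G : EuclideanSpace ℝ (Fin n) → EuclideanSpace ℝ (Fin n) :=
    fun y => (gauge D y ^ (1 / s) * ‖y‖⁻¹) • y with hG
  have hGn : ∀ y, ‖G y‖ = gauge D y ^ (1 / s) := by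
    intro y
    by_cases hy : y = 0
    · simp [hG, hy, Real.zero_rpow (inv_ne_zero hs0.ne')]
    have := norm_pos_iff.2 hy
    have := Real.rpow_nonneg (h.gauge_pos hy).le (1 / s)
    rw [hG, norm_smul, Real.norm_of_nonneg (by positivity)]
    field_simp
  have hleft : LeftInvOn G (radialExtension D s) (Metric.ball 0 1) := by
    intro x _
    by_cases hx : x = 0
    · simp [hx, hzero, hG]
    have hxp := norm_pos_iff.2 hx
    have hgp := h.gauge_pos hx
    have hρ : 0 < ‖x‖ ^ s * (gauge D x)⁻¹ := by positivity
    simp only [hG]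
    rw [h.gauge_radialExtension hs0, ← Real.rpow_mul hxp.le, mul_one_div_cancel hs0.ne',
      Real.rpow_one, h.radialExtension_eq, norm_smul, Real.norm_of_nonneg hρ.le, smul_smul]
    convert one_smul ℝ x using 2
    field_simp
  have hright : ∀ y, radialExtension D s (G y) = y := by
    intro y
    by_cases hy : y = 0
    · simp [hG, hy, hzero]
    have hyp := norm_pos_iff.2 hy
    have hgp := h.gauge_pos hy
    rw [h.radialExtension_eq, hGn, ← Real.rpow_mul hgp.le, one_div_mul_cancel hs0.ne',
      Real.rpow_one]
    simp only [hG]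
    rw [gauge_smul _ (by positivity), smul_smul]
    convert one_smul ℝ y using 2
    field_simp
  refine ⟨⟨fun x hx => ?_, hleft.injOn, fun y hy => ⟨G y, ?_, hright y⟩⟩, ?_, G, ?_, hleft⟩
  · rw [h.mem_iff, h.gauge_radialExtension hs0]
    exact Real.rpow_lt_one (norm_nonneg x) (mem_ball_zero_iff.1 hx) hs0
  · rw [mem_ball_zero_iff, hGn]
    exact Real.rpow_lt_one (gauge_nonneg y) (h.mem_iff.1 hy) (by positivity)
  · obtain ⟨C, hC⟩ := h.lipschitzOnWith_radialExtension hs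
    exact hC.continuousOn
  · have hc : Continuous fun y : EuclideanSpace ℝ (Fin n) => gauge D y ^ (1 / s) :=
      h.continuous_gauge.rpow_const fun _ => Or.inr (by positivity)
    refine Continuous.continuousOn (continuous_iff_continuousAt.2 fun y => ?_)
    by_cases hy : y = 0
    · have hG0 : G y = 0 := by simp [hG, hy]
      rw [ContinuousAt, hG0, tendsto_zero_iff_norm_tendsto_zero]
      simp only [hGn]
      convert hc.tendsto y
      simp [hy, Real.zero_rpow (inv_ne_zero hs0.ne')]
    · exact (hc.continuousAt.mul (continuousAt_id.norm.inv₀ (norm_ne_zero_iff.2 hy))).smul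
        continuousAt_id

theorem hasFDerivAt_radialExtension (h : IsPinchedConvex D a b) (hs : 1 ≤ s)
    {x : EuclideanSpace ℝ (Fin n)} (hx : x ≠ 0) (hd : DifferentiableAt ℝ (gauge D) x) :
    DifferentiableAt ℝ (radialExtension D s) x ∧
    IsRadialDerivative (fderiv ℝ (radialExtension D s) x) (‖x‖ ^ s * (gauge D x)⁻¹) s
      (‖x‖⁻¹ • x) ((‖x‖ * (gauge D x)⁻¹) • gradient (gauge D) x) := by
  have hxp := norm_pos_iff.2 hx
  have hgp := h.gauge_pos hx
  -- The squared norm is smooth, so the power is differentiated through it.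
  have hfun : radialExtension D s = fun x => ((‖x‖ ^ 2) ^ (s / 2) * (gauge D x)⁻¹) • x := by
    funext x
    rw [h.radialExtension_eq, ← Real.rpow_natCast, ← Real.rpow_mul (norm_nonneg x)]
    congr 3
    push_cast
    ring
  have h1 := (hasStrictFDerivAt_norm_sq x).hasFDerivAt.rpow_const (p := s / 2)
    (Or.inl (by positivity))
  have h2 := (hasDerivAt_inv hgp.ne').comp_hasFDerivAt x hd.hasFDerivAt
  have h3 := (h1.mul h2).smul (hasFDerivAt_id x)
  have hpow : (‖x‖ ^ 2) ^ (s / 2) = ‖x‖ ^ s := by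
    rw [← Real.rpow_natCast, ← Real.rpow_mul hxp.le]
    congr 1
    push_cast
    ring
  have hpow' : (‖x‖ ^ 2) ^ (s / 2 - 1) = ‖x‖ ^ s / ‖x‖ ^ 2 := by
    rw [Real.rpow_sub_one (by positivity), hpow]
  have h4 := h3.congr_of_eventuallyEq (f₁ := radialExtension D s)
    (Eventually.of_forall fun y => congrFun hfun y)
  refine ⟨h4.differentiableAt, ?_, by positivity, hs, norm_smul_inv_norm hx, ?_⟩
  · intro v
    rw [h4.fderiv]
    simp only [add_apply, smul_apply,
      ContinuousLinearMap.smulRight_apply, ContinuousLinearMap.id_apply, Function.comp,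
      innerSL_apply_apply, Pi.mul_apply, id, hpow, hpow', inner_sub_left, inner_smul_left,
      conj_trivial, inner_gradient_gauge, smul_eq_mul, nsmul_eq_mul, smul_add, smul_smul]
    congr 2
    push_cast
    field_simp
    ring
  · rw [inner_smul_left, inner_smul_right, inner_gradient_gauge, fderiv_gauge_apply_self hd,
      conj_trivial]
    field_simp

end IsPinchedConvex

/-! ### The dilatation of `φ°` in terms of the minimal angle -/

theorem cot_half_eq {m : ℝ} (h0 : 0 < m) (h1 : m ≤ Real.pi / 2) :
    Real.cot (m / 2) = 1 / Real.sin m + √((1 / Real.sin m) ^ 2 - 1) := by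
  have hpi := Real.pi_pos
  have hs : 0 < Real.sin m := Real.sin_pos_of_pos_of_lt_pi h0 (by linarith)
  have hc : 0 ≤ Real.cos m := Real.cos_nonneg_of_mem_Icc ⟨by linarith, h1⟩
  have hsq : √((1 / Real.sin m) ^ 2 - 1) = Real.cos m / Real.sin m := by
    rw [Real.sqrt_eq_iff_mul_self_eq (by
      have := Real.sin_le_one m
      rw [sub_nonneg]
      exact one_le_pow₀ ((one_le_div hs).2 this)) (by positivity)]
    have := Real.sin_sq_add_cos_sq m
    field_simp
    linarith
  have hs2 : Real.sin (m / 2) ≠ 0 := (Real.sin_pos_of_pos_of_lt_pi (by linarith) (by linarith)).ne'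
  have hc2 : Real.cos (m / 2) ≠ 0 := (Real.cos_pos_of_mem_Ioo ⟨by linarith, by linarith⟩).ne'
  have e1 : Real.sin m = 2 * Real.sin (m / 2) * Real.cos (m / 2) := by
    rw [← Real.sin_two_mul]
    congr 1
    ring
  have e2 : Real.cos m = 2 * Real.cos (m / 2) ^ 2 - 1 := by
    rw [← Real.cos_two_mul]
    congr 1
    ring
  rw [hsq, Real.cot_eq_cos_div_sin, ← add_div, e2, e1]
  field_simp
  ring

theorem strictMonoOn_add_sqrt : StrictMonoOn (fun x : ℝ => x + √(x ^ 2 - 1)) (Ici 1) := by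
  intro x hx y _ hxy
  have hx : (1 : ℝ) ≤ x := hx
  have : √(x ^ 2 - 1) ≤ √(y ^ 2 - 1) := Real.sqrt_le_sqrt (by nlinarith)
  exact add_lt_add_of_lt_of_le hxy this

theorem div_add_sqrt {a b : ℝ} (ha : 0 < a) :
    b / a + √((b / a) ^ 2 - 1) = (b + √(b ^ 2 - a ^ 2)) / a := by
  have h : (b / a) ^ 2 - 1 = (b ^ 2 - a ^ 2) / a ^ 2 := by
    field_simp
  rw [h, Real.sqrt_div' _ (sq_nonneg a), Real.sqrt_sq ha.le, add_div]

namespace IsPinchedConvex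

variable {n : ℕ} {D : Set (EuclideanSpace ℝ (Fin n))} {a b : ℝ}

theorem one_le_csc (h : IsPinchedConvex D a b) (hn : 2 ≤ n) :
    1 ≤ 1 / Real.sin (minTangentAngle D) :=
  (one_le_div (h.sin_minTangentAngle_pos hn)).2 (Real.sin_le_one _)

/-- Almost everywhere `φ°` has a derivative of radial type whose covector has norm at most
`1 / sin α_D`. -/
theorem ae_isRadialDerivative (h : IsPinchedConvex D a b) (hn : 2 ≤ n) :
    ∀ᵐ x : EuclideanSpace ℝ (Fin n), DifferentiableAt ℝ (phiCirc D) x ∧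
      IsRadialDerivative (fderiv ℝ (phiCirc D) x)
        (‖x‖ ^ (1 / Real.sin (minTangentAngle D)) * (gauge D x)⁻¹)
        (1 / Real.sin (minTangentAngle D)) (‖x‖⁻¹ • x)
        ((‖x‖ * (gauge D x)⁻¹) • gradient (gauge D) x) ∧
      ‖(‖x‖ * (gauge D x)⁻¹) • gradient (gauge D) x‖ ≤ 1 / Real.sin (minTangentAngle D) ∧
      1 ≤ ‖(‖x‖ * (gauge D x)⁻¹) • gradient (gauge D) x‖ ∧ x ≠ 0 := by
  have : Nontrivial (EuclideanSpace ℝ (Fin n)) := by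
    obtain ⟨v, hv, -⟩ := exists_norm_eq_one_inner_eq_zero hn 0
    exact ⟨v, 0, norm_pos_iff.1 (hv ▸ one_pos)⟩
  filter_upwards [h.ae_differentiableAt_gauge, Measure.ae_ne volume 0] with x hd hx
  obtain ⟨h1, h2⟩ := h.hasFDerivAt_radialExtension (h.one_le_csc hn) hx hd
  have hg := h.gauge_pos hx
  have hsin := h.sin_minTangentAngle_pos hn
  have hnorm : ‖(‖x‖ * (gauge D x)⁻¹) • gradient (gauge D) x‖ =
      ‖gradient (gauge D) x‖ * ‖x‖ / gauge D x := by
    rw [norm_smul, Real.norm_of_nonneg (by positivity)]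
    ring
  refine ⟨h1, h2, ?_, ?_, hx⟩
  · rw [hnorm, div_le_div_iff₀ hg hsin, one_mul, mul_comm]
    exact h.norm_gradient_gauge_mul_le hn hx hd
  · rw [hnorm, one_le_div hg]
    exact gauge_le_norm_gradient_mul hd

theorem isQuasiconformal_phiCirc (h : IsPinchedConvex D a b) (hn : 2 ≤ n) :
    IsQuasiconformal (phiCirc D) (Metric.ball 0 1) D := by
  have hs := h.one_le_csc hn
  obtain ⟨C, hC⟩ := h.lipschitzOnWith_radialExtension hs
  have hae := ae_restrict_of_ae (s := Metric.ball 0 1) (h.ae_isRadialDerivative hn)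
  refine ⟨h.isHomeoOnto_radialExtension hs, hC.isACL, hae.mono fun x hx => hx.1, _, ?_,
    hae.mono fun x hx => hx.2.1.quasiconformal_bounds hn hx.2.2.1⟩
  have hT := Real.sqrt_nonneg ((1 / Real.sin (minTangentAngle D)) ^ 2 - 1)
  exact one_le_mul_of_one_le_of_one_le hs (one_le_pow₀ (by linarith))

/-- The upper bound is pointwise. If the essential supremum were a smaller `K`, then `|N|² ≤ S`
almost everywhere for some `S < s²`, and the converse angle estimate would give a minimal angle
larger than `α_D`. -/
theorem essLinearDilatation_phiCirc (h : IsPinchedConvex D a b) (hn : 2 ≤ n) :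
    essLinearDilatation (phiCirc D) (Metric.ball 0 1) =
      ENNReal.ofReal (1 / Real.sin (minTangentAngle D) +
        √((1 / Real.sin (minTangentAngle D)) ^ 2 - 1)) := by
  have hs := h.one_le_csc hn
  have hae := ae_restrict_of_ae (s := Metric.ball 0 1) (h.ae_isRadialDerivative hn)
  have hle : essLinearDilatation (phiCirc D) (Metric.ball 0 1) ≤
      ENNReal.ofReal (1 / Real.sin (minTangentAngle D) +
        √((1 / Real.sin (minTangentAngle D)) ^ 2 - 1)) :=
    essSup_le_of_ae_le _ (hae.mono fun x hx => hx.2.1.linearDilatation_le hn hx.2.2.1)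
  refine hle.antisymm (not_lt.1 fun hlt => ?_)
  have haeE : ∀ᵐ x ∂(volume.restrict (Metric.ball (0 : EuclideanSpace ℝ (Fin n)) 1)),
      linearDilatation (fderiv ℝ (phiCirc D) x) ≤
        essLinearDilatation (phiCirc D) (Metric.ball 0 1) := ENNReal.ae_le_essSup _
  have hball : volume (Metric.ball (0 : EuclideanSpace ℝ (Fin n)) 1) ≠ 0 :=
    (Metric.measure_ball_pos volume 0 one_pos).ne'
  have hne : (ae (volume.restrict (Metric.ball (0 : EuclideanSpace ℝ (Fin n)) 1))).NeBot := by
    rw [ae_neBot, Ne, Measure.restrict_eq_zero]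
    exact hball
  generalize essLinearDilatation (phiCirc D) (Metric.ball 0 1) = E at hlt haeE
  set s := 1 / Real.sin (minTangentAngle D) with hsdef
  have hsin := h.sin_minTangentAngle_pos hn
  have hsq : √(s ^ 2 - 1) ^ 2 = s ^ 2 - 1 := Real.sq_sqrt (by nlinarith)
  have hT := Real.sqrt_nonneg (s ^ 2 - 1)
  set T := √(s ^ 2 - 1)
  have hEtop : E ≠ ⊤ := (hlt.trans ENNReal.ofReal_lt_top).ne
  have hKlt : E.toReal < s + T := (ENNReal.lt_ofReal_iff_toReal_lt hEtop).1 hlt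
  obtain ⟨x₀, hx₀, hx₀E⟩ := (hae.and haeE).exists
  have hE1 : 1 ≤ E := (hx₀.2.1.one_le_linearDilatation hn hx₀.2.2.1).trans hx₀E
  have hK1 : 1 ≤ E.toReal := by
    rwa [← ENNReal.ofReal_le_iff_le_toReal hEtop, ENNReal.ofReal_one]
  have hEK : E = ENNReal.ofReal E.toReal := (ENNReal.ofReal_toReal hEtop).symm
  set K := E.toReal
  have hkey : ∀ᵐ x ∂(volume.restrict (Metric.ball (0 : EuclideanSpace ℝ (Fin n)) 1)),
      ‖(‖x‖ * (gauge D x)⁻¹) • gradient (gauge D) x‖ ^ 2 ≤ s * (K ^ 2 + 1) / K - s ^ 2 := by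
    filter_upwards [hae, haeE] with x hx hxE
    have := hx.2.1.mul_norm_sq_le hn hx.2.2.1 hK1 (hEK ▸ hxE)
    rw [le_sub_iff_add_le, le_div_iff₀ (by linarith)]
    linarith
  set S := s * (K ^ 2 + 1) / K - s ^ 2
  -- `K` lies strictly between the roots `s ± T` of `X² - 2 s X + 1`, so `K² + 1 < 2 s K`.
  have hSlt : S < s ^ 2 := by
    have h1 : (s - T) * (s + T) = 1 := by linear_combination -hsq
    have h2 : s - T < 1 := by
      by_contra hcon
      nlinarith
    have h3 : s * (K ^ 2 + 1) / K < 2 * s ^ 2 := by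
      rw [div_lt_iff₀ (by linarith)]
      have h4 : 0 < (K - (s - T)) * (s + T - K) := mul_pos (by linarith) (by linarith)
      nlinarith
    simp only [S]
    linarith
  obtain ⟨x₁, hx₁, hx₁S⟩ := (hae.and hkey).exists
  have hS1 : 1 ≤ S := (one_le_pow₀ hx₁.2.2.2.1).trans hx₁S
  have hq : Real.arcsin (1 / √S) ≤ minTangentAngle D := by
    refine h.arcsin_le_minTangentAngle hn (by positivity) ?_
    filter_upwards [hae, hkey] with x hx hxS
    have hg := h.gauge_pos hx.2.2.2.2
    have h1 := Real.le_sqrt_of_sq_le hxS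
    rw [norm_smul, Real.norm_of_nonneg (by positivity)] at h1
    rw [one_div, inv_mul_le_iff₀ (Real.sqrt_pos.2 (by linarith))]
    calc _ = gauge D x * (‖x‖ * (gauge D x)⁻¹ * ‖gradient (gauge D) x‖) := by
          field_simp
      _ ≤ gauge D x * √S := by gcongr
      _ = _ := mul_comm _ _
  have hSs : √S < s := (Real.sqrt_lt' (by linarith)).2 hSlt
  have hSpos : 0 < √S := Real.sqrt_pos.2 (by linarith)
  have hsinlt : Real.sin (minTangentAngle D) < 1 / √S := by
    rw [lt_div_iff₀ hSpos]
    rw [hsdef, lt_div_iff₀ hsin] at hSs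
    linarith
  have hmono := Real.strictMonoOn_arcsin ⟨by linarith, Real.sin_le_one _⟩
    (show 1 / √S ∈ Icc (-1 : ℝ) 1 from ⟨by linarith [Real.neg_one_le_sin (minTangentAngle D)],
      (div_le_one hSpos).2 (Real.one_le_sqrt.2 hS1)⟩) hsinlt
  rw [Real.arcsin_sin (by linarith [h.minTangentAngle_pos hn, Real.pi_pos])
    (h.minTangentAngle_le_pi_div_two hn)] at hmono
  exact hmono.not_ge hq

theorem div_le_sin_minTangentAngle (h : IsPinchedConvex D a b) (hn : 2 ≤ n) :
    a / b ≤ Real.sin (minTangentAngle D) := by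
  have hm := h.minTangentAngle_pos hn
  have hpos : 0 < a / b := div_pos h.pos h.pos_right
  have hab : a / b ≤ 1 := by
    obtain ⟨y, hy⟩ := h.nonempty_frontier hn
    have h1 := (h.mul_gauge_le y).trans (h.norm_le_mul_gauge y)
    rw [h.mem_frontier_iff.1 hy, mul_one, mul_one] at h1
    exact (div_le_one h.pos_right).2 h1
  exact (Real.arcsin_le_iff_le_sin ⟨by linarith, hab⟩ ⟨by linarith [Real.pi_pos],
    h.minTangentAngle_le_pi_div_two hn⟩).1 (h.arcsin_div_le_minTangentAngle hn)

theorem csc_le_div (h : IsPinchedConvex D a b) (hn : 2 ≤ n) :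
    1 / Real.sin (minTangentAngle D) ≤ b / a := by
  have := h.div_le_sin_minTangentAngle hn
  rw [div_le_div_iff₀ (h.sin_minTangentAngle_pos hn) h.pos]
  rw [div_le_iff₀ h.pos_right] at this
  linarith

theorem essLinearDilatation_phiCirc_le (h : IsPinchedConvex D a b) (hn : 2 ≤ n) :
    essLinearDilatation (phiCirc D) (Metric.ball 0 1) ≤
      ENNReal.ofReal ((b + √(b ^ 2 - a ^ 2)) / a) := by
  have h1 := h.csc_le_div hn
  have hs := h.one_le_csc hn
  rw [h.essLinearDilatation_phiCirc hn, ← div_add_sqrt h.pos]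
  exact ENNReal.ofReal_le_ofReal (strictMonoOn_add_sqrt.monotoneOn hs (hs.trans h1) h1)

theorem essLinearDilatation_phiCirc_eq_iff (h : IsPinchedConvex D a b) (hn : 2 ≤ n) :
    essLinearDilatation (phiCirc D) (Metric.ball 0 1) =
      ENNReal.ofReal ((b + √(b ^ 2 - a ^ 2)) / a) ↔ minTangentAngle D = Real.arcsin (a / b) := by
  have h1 := h.csc_le_div hn
  have hs := h.one_le_csc hn
  have hab : 1 ≤ b / a := hs.trans h1
  have ha := h.pos
  have hb := h.pos_right
  have hsin := h.sin_minTangentAngle_pos hn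
  have hm0 := h.minTangentAngle_pos hn
  have hm1 := h.minTangentAngle_le_pi_div_two hn
  rw [h.essLinearDilatation_phiCirc hn, ← div_add_sqrt h.pos,
    ENNReal.ofReal_eq_ofReal_iff (by positivity) (by positivity),
    strictMonoOn_add_sqrt.injOn.eq_iff hs hab]
  constructor
  · intro he
    have h2 : Real.sin (minTangentAngle D) = a / b := by
      rw [← inv_div b a, ← he, one_div, inv_inv]
    rw [← h2, Real.arcsin_sin (by linarith) hm1]
  · intro he
    rw [he, Real.sin_arcsin (by linarith [div_pos ha hb])
      ((div_le_one hb).2 ((one_le_div ha).1 hab)), one_div_div]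

end IsPinchedConvex

/-! ### An extremal domain -/

/-- The ball of radius `b` is cut by a half-space at distance `a` from the origin. At a point of the
rim, at distance `b`, a segment in the flat face makes with the ray an angle of sine `a/b`. -/
theorem exists_isPinchedConvex_minTangentAngle_eq {n : ℕ} (hn : 2 ≤ n) {a b : ℝ} (ha : 0 < a)
    (hab : a < b) : ∃ D : Set (EuclideanSpace ℝ (Fin n)), IsPinchedConvex D a b ∧
      minTangentAngle D = Real.arcsin (a / b) := by
  have hb : 0 < b := ha.trans hab
  obtain ⟨u, hu, -⟩ := exists_norm_eq_one_inner_eq_zero hn 0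
  obtain ⟨v, hv, huv⟩ := exists_norm_eq_one_inner_eq_zero hn u
  set c := √(b ^ 2 - a ^ 2) with hc
  have hc2 : c ^ 2 = b ^ 2 - a ^ 2 := Real.sq_sqrt (by nlinarith)
  have hcp : 0 < c := Real.sqrt_pos.2 (by nlinarith)
  set D : Set (EuclideanSpace ℝ (Fin n)) := Metric.ball 0 b ∩ {x | inner ℝ u x < a} with hD
  have hP : IsPinchedConvex D a b := by
    refine ⟨Metric.isOpen_ball.inter (isOpen_lt (by fun_prop) (by fun_prop)),
      (convex_ball 0 b).inter ?_, ha, fun x hx => ⟨Metric.ball_subset_ball hab.le hx, ?_⟩,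
      inter_subset_left⟩
    · exact convex_halfSpace_lt (f := fun x => inner ℝ u x) (innerₛₗ ℝ u).isLinear a
    · have := real_inner_le_norm u x
      rw [hu, one_mul] at this
      exact this.trans_lt (mem_ball_zero_iff.1 hx)
  refine ⟨D, hP, le_antisymm ?_ (hP.arcsin_div_le_minTangentAngle hn)⟩
  -- `z θ` runs along the flat face and reaches the rim at `θ = 1`, since `a² + c² = b²`.
  set z : ℝ → EuclideanSpace ℝ (Fin n) := fun θ => a • u + (θ * c) • v with hz
  have hzu : ∀ θ, inner ℝ u (z θ) = a := by
    intro θ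
    simp [hz, inner_add_right, inner_smul_right, huv, hu]
  have hzn : ∀ θ, ‖z θ‖ ^ 2 = a ^ 2 + (θ * c) ^ 2 := by
    intro θ
    simp [hz, norm_add_sq_real, inner_smul_left, inner_smul_right, huv, norm_smul, hu, hv, mul_pow]
  have hzf : ∀ θ ∈ Ioc (0 : ℝ) 1, z θ ∈ frontier D := by
    intro θ hθ
    have hzb : ‖z θ‖ ≤ b := by
      refine (pow_le_pow_iff_left₀ (norm_nonneg _) hb.le two_ne_zero).1 ?_
      rw [hzn, mul_pow, hc2]
      have : θ ^ 2 ≤ 1 := pow_le_one₀ hθ.1.le hθ.2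
      nlinarith
    rw [frontier, hP.isOpen.interior_eq]
    refine ⟨?_, fun hmem => (hzu θ).not_lt hmem.2⟩
    -- The points `t • z θ` with `0 < t < 1` lie in `D`, which puts `z θ` in the closure.
    have ht : Tendsto (fun t : ℝ => t • z θ) (𝓝[<] 1) (𝓝 (z θ)) := by
      have : Continuous fun t : ℝ => t • z θ := by fun_prop
      simpa using (this.tendsto 1).mono_left nhdsWithin_le_nhds
    refine mem_closure_of_tendsto ht ?_
    filter_upwards [Ioo_mem_nhdsLT (zero_lt_one (α := ℝ))] with t ht
    refine ⟨?_, ?_⟩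
    · rw [mem_ball_zero_iff, norm_smul, Real.norm_of_nonneg ht.1.le]
      nlinarith [ht.1, ht.2, norm_nonneg (z θ)]
    · change inner ℝ u (t • z θ) < a
      rw [inner_smul_right, hzu]
      nlinarith [ht.2]
  have hz1 : z 1 ∈ frontier D := hzf 1 ⟨one_pos, le_rfl⟩
  have hz1n : ‖z 1‖ = b := by
    refine (pow_left_inj₀ (norm_nonneg _) hb.le two_ne_zero).1 ?_
    rw [hzn, one_mul, hc2]
    ring
  have hsub : ∀ θ, z θ - z 1 = ((θ - 1) * c) • v := by
    intro θ
    simp only [hz]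
    module
  have hv0 : v ≠ 0 := norm_pos_iff.1 (hv ▸ one_pos)
  have hvz : inner ℝ v (z 1) = c := by
    simp [hz, inner_add_right, inner_smul_right, real_inner_comm, huv, hv]
  have hang : ∀ θ < 1, segmentAngle (z θ) (z 1) = Real.arcsin (a / b) := by
    intro θ hθ
    have hneg : (θ - 1) * c < 0 := mul_neg_of_neg_of_pos (by linarith) hcp
    rw [segmentAngle_eq_arccos, hsub, inner_smul_left, hvz, norm_smul, hv, hz1n, conj_trivial,
      Real.arcsin_eq_arccos (by positivity), Real.norm_eq_abs]
    simp only [abs_div, abs_mul, abs_abs, abs_of_pos hcp, abs_of_pos hb, mul_one]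
    have hθ' : |θ - 1| ≠ 0 := abs_ne_zero.2 (by linarith)
    congr 1
    rw [mul_div_mul_left _ _ (by positivity), eq_comm,
      Real.sqrt_eq_iff_mul_self_eq_of_pos (by positivity), ← sq, div_pow, hc2]
    field_simp
  have htz : Tendsto z (𝓝[<] 1) (𝓝[frontier D \ {z 1}] (z 1)) := by
    refine tendsto_nhdsWithin_iff.2 ⟨?_, ?_⟩
    · have : Continuous z := by fun_prop
      exact (this.tendsto 1).mono_left nhdsWithin_le_nhds
    · filter_upwards [Ioo_mem_nhdsLT (zero_lt_one (α := ℝ))] with t ht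
      refine ⟨hzf t ⟨ht.1, ht.2.le⟩, fun he => ?_⟩
      have h0 : z t - z 1 = 0 := sub_eq_zero.2 he
      rw [hsub] at h0
      exact smul_ne_zero (mul_ne_zero (by linarith [ht.2]) hcp.ne') hv0 h0
  have hev : ∀ᶠ θ in 𝓝[<] (1 : ℝ), segmentAngle (z θ) (z 1) ≤ Real.arcsin (a / b) :=
    eventually_nhdsWithin_of_forall fun θ hθ => (hang θ hθ).le
  exact (hP.minTangentAngle_le hn hz1).trans
    (liminf_le_of_frequently_le (htz.frequently hev.frequently) (isBoundedUnder_segmentAngle _ _))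

theorem mainTheorem12 (n : ℕ) (hn : 2 ≤ n) (a b : ℝ) (ha : 0 < a) (hab : a < b) :
    (∀ D : Set (EuclideanSpace ℝ (Fin n)), IsOpen D → Convex ℝ D →
      Metric.ball 0 a ⊆ D → D ⊆ Metric.ball 0 b →
        IsStrictlyStarlike D ∧
        IsGreatest {α : ℝ | TangentCondition D α} (minTangentAngle D) ∧
        IsQuasiconformal (phiCirc D) (Metric.ball 0 1) D ∧
        infLinearDilatation D ≤ essLinearDilatation (phiCirc D) (Metric.ball 0 1) ∧
        essLinearDilatation (phiCirc D) (Metric.ball 0 1) =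
          ENNReal.ofReal (Real.cot (minTangentAngle D / 2)) ∧
        essLinearDilatation (phiCirc D) (Metric.ball 0 1) ≤
          ENNReal.ofReal ((b + Real.sqrt (b ^ 2 - a ^ 2)) / a) ∧
        (essLinearDilatation (phiCirc D) (Metric.ball 0 1) =
          ENNReal.ofReal ((b + Real.sqrt (b ^ 2 - a ^ 2)) / a) ↔
            minTangentAngle D = Real.arcsin (a / b))) ∧
    (∃ D : Set (EuclideanSpace ℝ (Fin n)), IsOpen D ∧ Convex ℝ D ∧
      Metric.ball 0 a ⊆ D ∧ D ⊆ Metric.ball 0 b ∧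
        essLinearDilatation (phiCirc D) (Metric.ball 0 1) =
          ENNReal.ofReal ((b + Real.sqrt (b ^ 2 - a ^ 2)) / a)) ∧
    (b + Real.sqrt (b ^ 2 - a ^ 2)) / a < 2 * (b / a) := by
  refine ⟨fun D ho hc h1 h2 => ?_, ?_, ?_⟩
  · have h : IsPinchedConvex D a b := ⟨ho, hc, ha, h1, h2⟩
    have hq := h.isQuasiconformal_phiCirc hn
    refine ⟨h.isStrictlyStarlike, h.isGreatest_minTangentAngle hn, hq, iInf₂_le (phiCirc D) hq, ?_,
      h.essLinearDilatation_phiCirc_le hn, h.essLinearDilatation_phiCirc_eq_iff hn⟩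
    rw [h.essLinearDilatation_phiCirc hn,
      cot_half_eq (h.minTangentAngle_pos hn) (h.minTangentAngle_le_pi_div_two hn)]
  · obtain ⟨D, h, hm⟩ := exists_isPinchedConvex_minTangentAngle_eq hn ha hab
    exact ⟨D, h.isOpen, h.convex, h.ball_subset, h.subset_ball,
      (h.essLinearDilatation_phiCirc_eq_iff hn).2 hm⟩
  · have hb : 0 < b := ha.trans hab
    have : √(b ^ 2 - a ^ 2) < b := (Real.sqrt_lt' hb).2 (by nlinarith)
    rw [← mul_div_assoc]
    gcongr
    linarith
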